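/- Let $n\ge 1$, $p>1+2/n$, and let $f\colon\mathbb R\to\mathbb R$ satisfy $f(0)=0$ and, for some $K>0$, $$|f(\xi)-f(\eta)|\le K\left(|\xi|^{p-1}+|\eta|^{p-1}\right)|\xi-\eta|\qquad\text{for all }\xi,\eta\in\mathbb R .$$ Write $e^{t\Delta}\varphi=G_t*\varphi$ for $t>0$, with $G_t(x)=(4\pi t)^{-n/2}e^{-|x|^2/(4t)}$, and $e^{0\Delta}\varphi=\varphi$. Let $\|\cdot\|_q$ denote the norm of $L^q=L^q(\mathbb R^n)$, and let $$X=(C\cap L^\infty)\left([0,\infty);L^1\right)\cap(C\cap L^\infty)\left((0,\infty);L^\infty\right).$$ For an integer $m\ge 1$ let $L^1_m$ be the space of all $\varphi\in L^1$ with $x^\alpha\varphi\in L^1$ for all multi-indices $\alpha\in\mathbb Z_{\ge0}^n$ with $|\alpha|=\alpha_1+\dots+\alpha_n\le m$, with norm $\sum_{|\alpha|\le m}\|x^\alpha\varphi\|_1$. A global mild solution with initial value $\varphi$ is a function $u$ such that, for all $t\ge0$, $$u(t)=e^{t\Delta}\varphi+\int_0^t e^{(t-s)\Delta}f(u(s))\,ds\qquad\text{a.e.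 on }\mathbb R^n .$$ Then there exists $\varepsilon_0>0$ with the following two properties. (i) For every $\varphi\in L^1\cap L^\infty$ with $\|\varphi\|_1+\|\varphi\|_\infty\le\varepsilon_0$ there is a unique global mild solution $u\in X$ with initial value $\varphi$, and it satisfies $$\sup_{q\in[1,\infty]}\ \sup_{t\ge0}\ (1+t)^{\frac n2\left(1-\frac1q\right)}\|u(t)\|_q<\infty .$$ (ii) For every integer $m\ge1$ and every $\varphi\in L^1_m\cap L^\infty$ with $\|\varphi\|_1+\|\varphi\|_\infty\le\varepsilon_0$, the solution $u\in X$ of (i) belongs to $C([0,\infty);L^1_m)$, and there exists $C_m>0$ such that $$\sum_{|\alpha|=m}\|x^\alpha u(t)\|_1\le C_m\left(1+t^{m/2}\right)\qquad\text{for all }t\ge0 .$$ -/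

import Mathlib

open MeasureTheory Filter Topology
open scoped ENNReal NNReal

noncomputable section

namespace SemilinearHeat

/-- `ℝⁿ` with its Euclidean norm and Lebesgue measure. -/
abbrev Rn (n : ℕ) : Type := EuclideanSpace ℝ (Fin n)

/-- The Gauss kernel `G_t(x) = (4πt)^{-n/2} exp(-|x|²/(4t))`. -/
def gaussKernel {n : ℕ} (t : ℝ) (x : Rn n) : ℝ :=
  (4 * Real.pi * t) ^ (-((n : ℝ) / 2)) * Real.exp (-(‖x‖ ^ 2 / (4 * t)))

/-- The heat semigroup: `e^{tΔ} φ = G_t * φ` for `t > 0`, and `e^{0Δ} φ = φ`. -/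
def heat {n : ℕ} (t : ℝ) (φ : Rn n → ℝ) (x : Rn n) : ℝ :=
  if 0 < t then ∫ y, gaussKernel t (x - y) * φ y else φ x

/-- The monomial `x^α = ∏ⱼ xⱼ^{αⱼ}`. -/
def monomial {n : ℕ} (α : Fin n → ℕ) (x : Rn n) : ℝ :=
  ∏ j, x j ^ α j

/-- The multi-indices `α ∈ ℕⁿ` of order `|α| = k`. -/
def multiIndices (n k : ℕ) : Finset (Fin n → ℕ) :=
  Finset.piAntidiag Finset.univ k

/-- The weighted quantity `∑_{|α| = k} ‖x^α φ‖₁`. -/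
def momentNorm {n : ℕ} (k : ℕ) (φ : Rn n → ℝ) : ℝ≥0∞ :=
  ∑ α ∈ multiIndices n k, eLpNorm (fun x => monomial α x * φ x) 1 volume

/-- `φ ∈ L¹_m(ℝⁿ)`: `φ` and all `x^α φ` with `|α| ≤ m` are in `L¹(ℝⁿ)`. -/
def MemWeightedL1 {n : ℕ} (m : ℕ) (φ : Rn n → ℝ) : Prop :=
  MemLp φ 1 volume ∧
    ∀ α : Fin n → ℕ, ∑ j, α j ≤ m → MemLp (fun x => monomial α x * φ x) 1 volume

/-- The norm `∑_{|α| ≤ m} ‖x^α φ‖₁` of `L¹_m(ℝⁿ)`. -/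
def weightedL1Norm {n : ℕ} (m : ℕ) (φ : Rn n → ℝ) : ℝ≥0∞ :=
  ∑ k ∈ Finset.range (m + 1), momentNorm k φ

/-- `u ∈ C(I; L^q(ℝⁿ))`, where `u t` is a representative of the value at time `t`. -/
def ContinuousInLp {n : ℕ} (q : ℝ≥0∞) (I : Set ℝ) (u : ℝ → Rn n → ℝ) : Prop :=
  (∀ t ∈ I, MemLp (u t) q volume) ∧
    ∀ t ∈ I, Tendsto (fun s => eLpNorm (fun x => u s x - u t x) q volume) (𝓝[I] t) (𝓝 0)

/-- The norms `‖u(t)‖_q` are bounded for `t ∈ I`. -/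
def BoundedInLp {n : ℕ} (q : ℝ≥0∞) (I : Set ℝ) (u : ℝ → Rn n → ℝ) : Prop :=
  ∃ M : ℝ≥0, ∀ t ∈ I, eLpNorm (u t) q volume ≤ M

/-- `u ∈ C(I; L¹_m(ℝⁿ))`. -/
def ContinuousInWeightedL1 {n : ℕ} (m : ℕ) (I : Set ℝ) (u : ℝ → Rn n → ℝ) : Prop :=
  (∀ t ∈ I, MemWeightedL1 m (u t)) ∧
    ∀ t ∈ I, Tendsto (fun s => weightedL1Norm m (fun x => u s x - u t x)) (𝓝[I] t) (𝓝 0)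

/-- The solution space
`X = (C ∩ L^∞)([0, ∞); L¹(ℝⁿ)) ∩ (C ∩ L^∞)((0, ∞); L^∞(ℝⁿ))`. -/
structure InX {n : ℕ} (u : ℝ → Rn n → ℝ) : Prop where
  continuous_L1 : ContinuousInLp 1 (Set.Ici 0) u
  bounded_L1 : BoundedInLp 1 (Set.Ici 0) u
  continuous_Linfty : ContinuousInLp ∞ (Set.Ioi 0) u
  bounded_Linfty : BoundedInLp ∞ (Set.Ioi 0) u

/-- `u` is a global mild solution of `∂_t u - Δu = f(u)`, `u(0) = φ`: for every `t ≥ 0`,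
`u(t) = e^{tΔ} φ + ∫₀ᵗ e^{(t-s)Δ} f(u(s)) ds` almost everywhere on `ℝⁿ`.
(For `u ∈ X` and `f` as in the theorem, for each `x` the integrand is continuous and bounded
in `s ∈ (0, t)`, and it does not depend on the choice of representatives.) -/
def IsMildSolution {n : ℕ} (f : ℝ → ℝ) (φ : Rn n → ℝ) (u : ℝ → Rn n → ℝ) : Prop :=
  ∀ t : ℝ, 0 ≤ t → ∀ᵐ x,
    u t x = heat t φ x + ∫ s in (0 : ℝ)..t, heat (t - s) (fun y => f (u s y)) x

/-- `sup_{q ∈ [1, ∞]} sup_{t ≥ 0} (1 + t)^{(n/2)(1 - 1/q)} ‖u(t)‖_q < ∞`. -/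
def HasHeatDecay {n : ℕ} (u : ℝ → Rn n → ℝ) : Prop :=
  ∃ M : ℝ≥0, ∀ q : ℝ≥0∞, 1 ≤ q → ∀ t : ℝ, 0 ≤ t →
    ENNReal.ofReal ((1 + t) ^ ((n : ℝ) / 2 * (1 - (q⁻¹).toReal))) * eLpNorm (u t) q volume ≤ M

end SemilinearHeat

end

namespace SemilinearHeat

section

variable {n : ℕ}

/-! ### The Gauss kernel -/

/-! Put `σ = (n/2)(p - 1)`; the hypothesis `p > 1 + 2/n` says exactly that `σ > 1`. If `‖u(s)‖_∞ ≤ M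
(1+s)^{-n/2}`, then `|f(u(s))| ≤ K M^{p-1} (1+s)^{-σ} |u(s)|`, so the nonlinearity acts like a
bounded potential whose size is integrable in time, with total mass small when `M` is small.

Existence: the Picard map preserves the ball `InBall M` of curves with `‖u(t)‖₁ ≤ M` and `‖u(t)‖_∞ ≤
M (1+t)^{-n/2}` (`InBall.picard`). The decay of the Duhamel term comes from splitting at `s = t/2`:
the smoothing `L¹ → L^∞` serves the early sources, the decay of the source itself the late ones
(`IsSource.enorm_duhamel_le_of_decay`). The map contracts by `1/2` in the supremum over time of the
`L¹` norm (`InBall.lintegral_picard_sub_le`), and the ball is closed there. Interpolation gives all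
`L^q` rates.

Uniqueness in `X` needs no smallness: bounded solutions see a globally Lipschitz `f`, and Gronwall
in `L¹` applies (`IsMildSolution.ae_eq`). Every small-data solution in `X` therefore lies in the
ball, and the weighted assertions need proof only there.

Moments: from `|x|^m ≤ 2^m (|x-y|^m + |y|^m)`, the semigroup adds a Gaussian moment of order
`t^{m/2}` to the moment of the data. Gronwall with the integrable coefficient `(1+s)^{-σ}` costs
only a constant factor (`InBall.lintegral_pow_mul_le`). Truncated weights avoid assuming the moment
finite beforehand. Continuity in `L¹_m` follows from continuity in `L¹` and tails that are small
uniformly on compact time intervals (`InBall.exists_tail_le`). -/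

theorem gaussKernel_nonneg {t : ℝ} (ht : 0 < t) (x : Rn n) : 0 ≤ gaussKernel t x := by
  unfold gaussKernel; positivity

theorem continuous_gaussKernel (t : ℝ) : Continuous (gaussKernel (n := n) t) := by
  unfold gaussKernel; fun_prop

theorem gaussKernel_le {t : ℝ} (ht : 0 < t) (x : Rn n) :
    gaussKernel t x ≤ (4 * Real.pi * t) ^ (-((n : ℝ) / 2)) := by
  unfold gaussKernel
  refine mul_le_of_le_one_right (by positivity) (Real.exp_le_one_iff.2 ?_)
  have : 0 ≤ ‖x‖ ^ 2 / (4 * t) := by positivity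
  linarith

theorem integral_gaussKernel {t : ℝ} (ht : 0 < t) : ∫ x : Rn n, gaussKernel t x = 1 := by
  unfold gaussKernel
  rw [integral_const_mul]
  have h := GaussianFourier.integral_rexp_neg_mul_sq_norm (V := Rn n) (b := 1 / (4 * t))
    (by positivity)
  have e : ∀ x : Rn n, -(1 / (4 * t)) * ‖x‖ ^ 2 = -(‖x‖ ^ 2 / (4 * t)) := fun x => by ring
  simp only [e] at h
  rw [h, finrank_euclideanSpace_fin, show Real.pi / (1 / (4 * t)) = 4 * Real.pi * t by field_simp,
    ← Real.rpow_add (by positivity)]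
  simp

theorem integrable_gaussKernel {t : ℝ} (ht : 0 < t) :
    Integrable (gaussKernel (n := n) t) :=
  .of_integral_ne_zero (by rw [integral_gaussKernel ht]; exact one_ne_zero)

theorem lintegral_gaussKernel {t : ℝ} (ht : 0 < t) :
    ∫⁻ x : Rn n, ‖gaussKernel t x‖ₑ = 1 := by
  rw [← ofReal_integral_norm_eq_lintegral_enorm (integrable_gaussKernel ht)]
  simp only [Real.norm_eq_abs, abs_of_nonneg (gaussKernel_nonneg ht _), integral_gaussKernel ht,
    ENNReal.ofReal_one]

/-- The exponential factor increases with time, so only the ratio of the normalizations is lost. -/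
theorem gaussKernel_le_mul {a b : ℝ} (ha : 0 < a) (hab : a ≤ b) (x : Rn n) :
    gaussKernel a x ≤ (b / a) ^ ((n : ℝ) / 2) * gaussKernel b x := by
  have hb : 0 < b := ha.trans_le hab
  unfold gaussKernel
  rw [← mul_assoc]
  have e : (b / a) ^ ((n : ℝ) / 2) * (4 * Real.pi * b) ^ (-((n : ℝ) / 2))
      = (4 * Real.pi * a) ^ (-((n : ℝ) / 2)) := by
    rw [Real.rpow_neg (by positivity), Real.rpow_neg (by positivity), ← Real.inv_rpow
      (by positivity), ← Real.inv_rpow (by positivity), ← Real.mul_rpow (by positivity)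
      (by positivity)]
    congr 1; field_simp
  rw [e]
  gcongr

theorem one_le_div_rpow {a b : ℝ} (ha : 0 < a) (hab : a ≤ b) :
    1 ≤ (b / a) ^ ((n : ℝ) / 2) :=
  Real.one_le_rpow ((one_le_div ha).2 hab) (by positivity)

/-- With `c = (b/a)^{n/2}`, write `G_b - G_a = (c G_b - G_a) - (c - 1) G_b`, a difference of two
nonnegative functions, each of integral `c - 1`. This gives continuity in time without
differentiating the kernel. -/
theorem lintegral_gaussKernel_sub_le {a b : ℝ} (ha : 0 < a) (hab : a ≤ b) :
    ∫⁻ x : Rn n, ‖gaussKernel b x - gaussKernel a x‖ₑ ≤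
      ENNReal.ofReal (2 * ((b / a) ^ ((n : ℝ) / 2) - 1)) := by
  have hb : 0 < b := ha.trans_le hab
  have hc := one_le_div_rpow (n := n) ha hab
  set c := (b / a) ^ ((n : ℝ) / 2)
  have ia := integrable_gaussKernel (n := n) ha
  have ib := integrable_gaussKernel (n := n) hb
  refine (ofReal_integral_norm_eq_lintegral_enorm (ib.sub ia)).symm.trans_le ?_
  refine ENNReal.ofReal_le_ofReal ?_
  calc ∫ x : Rn n, ‖gaussKernel b x - gaussKernel a x‖
      ≤ ∫ x : Rn n, ((c * gaussKernel b x - gaussKernel a x) + (c - 1) * gaussKernel b x) := by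
        refine integral_mono (ib.sub ia).norm (((ib.const_mul c).sub ia).add (ib.const_mul _)) ?_
        intro x
        have h1 : gaussKernel a x ≤ c * gaussKernel b x := gaussKernel_le_mul ha hab x
        have h2 := gaussKernel_nonneg hb x
        have h3 : 0 ≤ (c - 1) * gaussKernel b x := mul_nonneg (by linarith) h2
        exact abs_le.2 ⟨by linarith, by linarith⟩
    _ = 2 * (c - 1) := by
        have i1 : Integrable fun x : Rn n => c * gaussKernel b x - gaussKernel a x :=
          (ib.const_mul c).sub ia
        rw [integral_add i1 (ib.const_mul _),
          integral_sub (ib.const_mul c) ia, integral_const_mul, integral_const_mul,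
          integral_gaussKernel ha, integral_gaussKernel hb]
        ring

theorem lintegral_gaussKernel_sub_le_two {a b : ℝ} (ha : 0 < a) (hb : 0 < b) :
    ∫⁻ x : Rn n, ‖gaussKernel b x - gaussKernel a x‖ₑ ≤ 2 := by
  calc ∫⁻ x : Rn n, ‖gaussKernel b x - gaussKernel a x‖ₑ
      ≤ ∫⁻ x : Rn n, (‖gaussKernel b x‖ₑ + ‖gaussKernel a x‖ₑ) :=
        lintegral_mono fun x => enorm_sub_le
    _ = 2 := by
        rw [lintegral_add_left (continuous_gaussKernel b).measurable.enorm,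
          lintegral_gaussKernel ha, lintegral_gaussKernel hb, one_add_one_eq_two]

/-- The constant in the bound of the moments of the Gauss kernel. -/
noncomputable def momentConst (n m : ℕ) : ℝ :=
  m.factorial * Real.exp 2 * 2 ^ ((n : ℝ) / 2)

theorem momentConst_pos (n m : ℕ) : 0 < momentConst n m := by
  unfold momentConst; positivity

/-- Half of the Gaussian exponent pays for the polynomial: in the scaled variable `r = |x|/√t`, the
factor `r^m exp(-r²/4)` is at most a constant times `exp(-r²/8)`, the profile of `G_{2t}`. -/
theorem norm_pow_mul_gaussKernel_le {t : ℝ} (ht : 0 < t) (m : ℕ) (x : Rn n) :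
    ‖x‖ ^ m * gaussKernel t x ≤
      momentConst n m * t ^ ((m : ℝ) / 2) * gaussKernel (2 * t) x := by
  have hs : 0 < Real.sqrt t := Real.sqrt_pos.2 ht
  set r := ‖x‖ / Real.sqrt t with hr
  have hr0 : 0 ≤ r := by positivity
  have hx : ‖x‖ = r * Real.sqrt t := by rw [hr]; field_simp
  have hst : Real.sqrt t ^ 2 = t := Real.sq_sqrt ht.le
  have h1 : r ^ m ≤ m.factorial * Real.exp r := by
    have := Real.pow_div_factorial_le_exp r hr0 m
    rwa [div_le_iff₀' (by positivity)] at this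
  -- `r ≤ 2 + r²/8` is `(r - 4)² ≥ 0`.
  have h2 : Real.exp r ≤ Real.exp 2 * Real.exp (r ^ 2 / 8) := by
    rw [← Real.exp_add]
    exact Real.exp_le_exp.2 (by nlinarith [sq_nonneg (r - 4)])
  have hpow : Real.sqrt t ^ m = t ^ ((m : ℝ) / 2) := by
    rw [Real.sqrt_eq_rpow, ← Real.rpow_natCast, ← Real.rpow_mul ht.le]; congr 1; ring
  have h3 : (4 * Real.pi * t) ^ (-((n : ℝ) / 2)) =
      2 ^ ((n : ℝ) / 2) * (4 * Real.pi * (2 * t)) ^ (-((n : ℝ) / 2)) := by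
    rw [show 4 * Real.pi * (2 * t) = 2 * (4 * Real.pi * t) by ring,
      Real.mul_rpow (x := 2) (by positivity) (by positivity), ← mul_assoc,
      ← Real.rpow_add (by positivity)]
    simp
  have h4 : ‖x‖ ^ 2 / (4 * t) = r ^ 2 / 4 := by
    rw [hx, mul_pow, hst]; field_simp
  have h5 : ‖x‖ ^ 2 / (4 * (2 * t)) = r ^ 2 / 8 := by
    rw [hx, mul_pow, hst]; field_simp; ring
  unfold gaussKernel momentConst
  rw [h4, h5, h3]
  have h6 : r ^ m * Real.exp (-(r ^ 2 / 4)) ≤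
      m.factorial * Real.exp 2 * Real.exp (-(r ^ 2 / 8)) := by
    calc r ^ m * Real.exp (-(r ^ 2 / 4))
        ≤ (m.factorial * (Real.exp 2 * Real.exp (r ^ 2 / 8))) * Real.exp (-(r ^ 2 / 4)) := by
          gcongr; exact h1.trans (by gcongr)
      _ = m.factorial * Real.exp 2 * Real.exp (-(r ^ 2 / 8)) := by
          rw [show -(r ^ 2 / 8) = r ^ 2 / 8 + -(r ^ 2 / 4) by ring, Real.exp_add]; ring
  have hm : ‖x‖ ^ m = r ^ m * t ^ ((m : ℝ) / 2) := by rw [hx, mul_pow, hpow]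
  rw [hm]
  set P := (4 * Real.pi * (2 * t)) ^ (-((n : ℝ) / 2))
  have hP : 0 ≤ P := by positivity
  calc r ^ m * t ^ ((m : ℝ) / 2) * (2 ^ ((n : ℝ) / 2) * P * Real.exp (-(r ^ 2 / 4)))
      = t ^ ((m : ℝ) / 2) * (2 ^ ((n : ℝ) / 2) * P) * (r ^ m * Real.exp (-(r ^ 2 / 4))) := by ring
    _ ≤ t ^ ((m : ℝ) / 2) * (2 ^ ((n : ℝ) / 2) * P) *
          (m.factorial * Real.exp 2 * Real.exp (-(r ^ 2 / 8))) := by gcongr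
    _ = _ := by ring

theorem lintegral_pow_mul_gaussKernel_le {t : ℝ} (ht : 0 < t) (m : ℕ) :
    ∫⁻ x : Rn n, ‖x‖ₑ ^ m * ‖gaussKernel t x‖ₑ ≤
      ENNReal.ofReal (momentConst n m * t ^ ((m : ℝ) / 2)) := by
  have hC := momentConst_pos n m
  calc ∫⁻ x : Rn n, ‖x‖ₑ ^ m * ‖gaussKernel t x‖ₑ
      ≤ ∫⁻ x : Rn n, ENNReal.ofReal (momentConst n m * t ^ ((m : ℝ) / 2)) *
          ‖gaussKernel (2 * t) x‖ₑ := by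
        refine lintegral_mono fun x => ?_
        have h := norm_pow_mul_gaussKernel_le ht m x
        rw [Real.enorm_of_nonneg (gaussKernel_nonneg ht x),
          Real.enorm_of_nonneg (gaussKernel_nonneg (by positivity) x), ← ofReal_norm,
          ← ENNReal.ofReal_pow (norm_nonneg _), ← ENNReal.ofReal_mul (by positivity),
          ← ENNReal.ofReal_mul (by positivity)]
        exact ENNReal.ofReal_le_ofReal h
    _ = _ := by
        rw [lintegral_const_mul _ (continuous_gaussKernel _).measurable.enorm,
          lintegral_gaussKernel (by positivity), mul_one]

/-- Gaussian moments outside a ball of radius `R`. -/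
theorem lintegral_tail_gaussKernel_le {t R : ℝ} (ht : 0 < t) (hR : 0 < R) (m : ℕ) :
    ∫⁻ x in {x : Rn n | R < ‖x‖}, ‖x‖ₑ ^ m * ‖gaussKernel t x‖ₑ ≤
      ENNReal.ofReal (momentConst n (m + 1) * t ^ (((m + 1 : ℕ) : ℝ) / 2) / R) := by
  have h := lintegral_pow_mul_gaussKernel_le (n := n) ht (m + 1)
  -- Chebyshev: on `R < |x|` one more power of `|x|` dominates a factor `R`.
  have hR' : ENNReal.ofReal R ≠ 0 := by simpa using hR
  rw [ENNReal.ofReal_div_of_pos hR, ENNReal.le_div_iff_mul_le (.inl hR') (.inl ENNReal.ofReal_ne_top),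
    mul_comm, ← lintegral_const_mul']
  · refine le_trans ?_ h
    rw [← lintegral_indicator (measurableSet_lt measurable_const measurable_norm)]
    refine lintegral_mono fun x => ?_
    by_cases hx : R < ‖x‖
    · rw [Set.indicator_of_mem (by exact hx), pow_succ', mul_assoc]
      gcongr
      rw [← ofReal_norm]
      exact ENNReal.ofReal_le_ofReal hx.le
    · rw [Set.indicator_of_notMem (by exact hx)]; exact zero_le
  · exact ENNReal.ofReal_ne_top

end

section

variable {n : ℕ}

/-! ### Integral operators with a convolution kernel -/

/-- Young's inequality in `L¹` with a weight, by Tonelli and the translation `x = z + y`. Splitting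
the weight into separate functions `a` of the kernel variable and `b` of the data variable covers
constant weights, truncated powers and tail weights at once. -/
theorem lintegral_mul_enorm_conv_le {k φ : Rn n → ℝ} {w a b : Rn n → ℝ≥0∞} (hk : Measurable k)
    (hφ : AEMeasurable φ) (hw : Measurable w) (hb : Measurable b)
    (hwab : ∀ z y, w (z + y) ≤ a z + b y) :
    ∫⁻ x, w x * ‖∫ y, k (x - y) * φ y‖ₑ ≤
      (∫⁻ z, a z * ‖k z‖ₑ) * (∫⁻ y, ‖φ y‖ₑ) + (∫⁻ z, ‖k z‖ₑ) * ∫⁻ y, b y * ‖φ y‖ₑ := by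
  have hφ2 : AEMeasurable (fun z : Rn n × Rn n => ‖φ z.2‖ₑ) :=
    (hφ.comp_quasiMeasurePreserving Measure.quasiMeasurePreserving_snd).enorm
  calc ∫⁻ x, w x * ‖∫ y, k (x - y) * φ y‖ₑ
      ≤ ∫⁻ x, ∫⁻ y, w x * (‖k (x - y)‖ₑ * ‖φ y‖ₑ) := by
        refine lintegral_mono fun x => ?_
        have hm : AEMeasurable fun y => ‖k (x - y)‖ₑ * ‖φ y‖ₑ :=
          (hk.comp (measurable_const.sub measurable_id)).enorm.aemeasurable.mul hφ.enorm
        rw [lintegral_const_mul'' _ hm]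
        gcongr
        refine (enorm_integral_le_lintegral_enorm _).trans (le_of_eq ?_)
        simp only [enorm_mul]
    _ = ∫⁻ y, ∫⁻ x, w x * (‖k (x - y)‖ₑ * ‖φ y‖ₑ) := by
        refine lintegral_lintegral_swap ?_
        refine (hw.comp measurable_fst).aemeasurable.mul (AEMeasurable.mul ?_ hφ2)
        exact (hk.comp (measurable_fst.sub measurable_snd)).enorm.aemeasurable
    _ ≤ ∫⁻ y, ((∫⁻ z, a z * ‖k z‖ₑ) * ‖φ y‖ₑ + (∫⁻ z, ‖k z‖ₑ) * (b y * ‖φ y‖ₑ)) := by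
        refine lintegral_mono fun y => ?_
        have h1 : ∫⁻ x, w x * (‖k (x - y)‖ₑ * ‖φ y‖ₑ) =
            (∫⁻ z, w (z + y) * ‖k z‖ₑ) * ‖φ y‖ₑ := by
          rw [← lintegral_mul_const _ (by fun_prop),
            ← lintegral_sub_right_eq_self (fun z => w (z + y) * ‖k z‖ₑ * ‖φ y‖ₑ) y]
          simp only [sub_add_cancel, mul_assoc]
        have h2 : ∫⁻ z, w (z + y) * ‖k z‖ₑ ≤
            (∫⁻ z, a z * ‖k z‖ₑ) + b y * ∫⁻ z, ‖k z‖ₑ := by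
          rw [← lintegral_const_mul _ hk.enorm, ← lintegral_add_right _ (hk.enorm.const_mul _)]
          refine lintegral_mono fun z => ?_
          rw [← add_mul]
          gcongr
          exact hwab z y
        rw [h1]
        refine (mul_le_mul_left h2 _).trans (le_of_eq ?_)
        ring
    _ = _ := by
        have hm : AEMeasurable fun y => b y * ‖φ y‖ₑ := hb.aemeasurable.mul hφ.enorm
        rw [lintegral_add_left' (hφ.enorm.const_mul _), lintegral_const_mul'' _ hφ.enorm,
          lintegral_const_mul'' _ hm]

theorem lintegral_enorm_conv_le {k φ : Rn n → ℝ} (hk : Measurable k) (hφ : AEMeasurable φ) :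
    ∫⁻ x, ‖∫ y, k (x - y) * φ y‖ₑ ≤ (∫⁻ z, ‖k z‖ₑ) * ∫⁻ y, ‖φ y‖ₑ := by
  have := lintegral_mul_enorm_conv_le (w := fun _ => 1) (a := fun _ => 0) (b := fun _ => 1) hk hφ
    measurable_const measurable_const (by simp)
  simpa using this

theorem enorm_conv_le_of_ae_le {k φ : Rn n → ℝ} (hk : Measurable k) {A : ℝ≥0∞}
    (hA : ∀ᵐ y, ‖φ y‖ₑ ≤ A) (x : Rn n) :
    ‖∫ y, k (x - y) * φ y‖ₑ ≤ (∫⁻ z, ‖k z‖ₑ) * A := by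
  calc ‖∫ y, k (x - y) * φ y‖ₑ ≤ ∫⁻ y, ‖k (x - y) * φ y‖ₑ := enorm_integral_le_lintegral_enorm _
    _ ≤ ∫⁻ y, ‖k (x - y)‖ₑ * A := by
        refine lintegral_mono_ae ?_
        filter_upwards [hA] with y hy
        rw [enorm_mul]
        gcongr
    _ = (∫⁻ z, ‖k z‖ₑ) * A := by
        rw [lintegral_mul_const _ (by fun_prop),
          lintegral_sub_left_eq_self (fun z => ‖k z‖ₑ)]

theorem enorm_conv_le_of_kernel_le {k φ : Rn n → ℝ} {c : ℝ≥0∞} (hc : ∀ z, ‖k z‖ₑ ≤ c)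
    (hφ : AEMeasurable φ) (x : Rn n) :
    ‖∫ y, k (x - y) * φ y‖ₑ ≤ c * ∫⁻ y, ‖φ y‖ₑ := by
  rw [← lintegral_const_mul'' _ hφ.enorm]
  refine (enorm_integral_le_lintegral_enorm _).trans (lintegral_mono fun y => ?_)
  rw [enorm_mul]
  gcongr
  exact hc _

/-! ### The heat semigroup -/

theorem heat_of_pos {t : ℝ} (ht : 0 < t) (φ : Rn n → ℝ) (x : Rn n) :
    heat t φ x = ∫ y, gaussKernel t (x - y) * φ y := if_pos ht

theorem heat_of_nonpos {t : ℝ} (ht : t ≤ 0) (φ : Rn n → ℝ) : heat t φ = φ :=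
  funext fun _ => if_neg ht.not_gt

theorem heat_congr_ae {t : ℝ} {φ ψ : Rn n → ℝ} (ht : 0 < t) (h : φ =ᵐ[volume] ψ) (x : Rn n) :
    heat t φ x = heat t ψ x := by
  rw [heat_of_pos ht, heat_of_pos ht]
  refine integral_congr_ae ?_
  filter_upwards [h] with y hy
  rw [hy]

theorem measurable_gaussKernel (t : ℝ) : Measurable (gaussKernel (n := n) t) :=
  (continuous_gaussKernel t).measurable

theorem norm_gaussKernel_le {t : ℝ} (ht : 0 < t) (x : Rn n) :
    ‖gaussKernel t x‖ ≤ (4 * Real.pi * t) ^ (-((n : ℝ) / 2)) := by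
  rw [Real.norm_of_nonneg (gaussKernel_nonneg ht x)]
  exact gaussKernel_le ht x

theorem integrable_gaussKernel_mul {t : ℝ} (ht : 0 < t) {φ : Rn n → ℝ} (hφ : Integrable φ)
    (x : Rn n) : Integrable fun y => gaussKernel t (x - y) * φ y :=
  hφ.bdd_mul ((continuous_gaussKernel t).comp (by fun_prop)).aestronglyMeasurable
    (ae_of_all _ fun y => norm_gaussKernel_le ht (x - y))

theorem continuous_heat {t : ℝ} (ht : 0 < t) {φ : Rn n → ℝ} (hφ : Integrable φ) :
    Continuous (heat t φ) := by
  have : heat t φ = fun x => ∫ y, gaussKernel t (x - y) * φ y := funext (heat_of_pos ht φ)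
  rw [this]
  refine continuous_of_dominated (bound := fun y => (4 * Real.pi * t) ^ (-((n : ℝ) / 2)) * ‖φ y‖)
    (fun x => (integrable_gaussKernel_mul ht hφ x).1) (fun x => ae_of_all _ fun y => ?_)
    (hφ.norm.const_mul _) (ae_of_all _ fun y => ?_)
  · rw [norm_mul]
    gcongr
    exact norm_gaussKernel_le ht _
  · exact ((continuous_gaussKernel t).comp (by fun_prop)).mul_const _

theorem aestronglyMeasurable_heat (t : ℝ) {φ : Rn n → ℝ} (hφ : Integrable φ) :
    AEStronglyMeasurable (heat t φ) := by
  rcases lt_or_ge 0 t with ht | ht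
  · exact (continuous_heat ht hφ).aestronglyMeasurable
  · rw [heat_of_nonpos ht]; exact hφ.1

theorem heat_sub {t : ℝ} {φ ψ : Rn n → ℝ} (hφ : Integrable φ) (hψ : Integrable ψ) (x : Rn n) :
    heat t φ x - heat t ψ x = heat t (fun y => φ y - ψ y) x := by
  rcases lt_or_ge 0 t with ht | ht
  · rw [heat_of_pos ht, heat_of_pos ht, heat_of_pos ht, ← integral_sub
      (integrable_gaussKernel_mul ht hφ x) (integrable_gaussKernel_mul ht hψ x)]
    simp only [mul_sub]
  · simp only [heat_of_nonpos ht]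

theorem heat_time_sub {a b : ℝ} (ha : 0 < a) (hb : 0 < b) {φ : Rn n → ℝ} (hφ : Integrable φ)
    (x : Rn n) :
    heat b φ x - heat a φ x = ∫ y, (gaussKernel b (x - y) - gaussKernel a (x - y)) * φ y := by
  rw [heat_of_pos ha, heat_of_pos hb, ← integral_sub (integrable_gaussKernel_mul hb hφ x)
    (integrable_gaussKernel_mul ha hφ x)]
  simp only [sub_mul]

theorem lintegral_mul_enorm_heat_le {t : ℝ} (ht : 0 ≤ t) {φ : Rn n → ℝ} {w a b : Rn n → ℝ≥0∞}
    (hφ : AEMeasurable φ) (hw : Measurable w) (hb : Measurable b)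
    (hwab : ∀ z y, w (z + y) ≤ a z + b y) (hwb : ∀ y, w y ≤ b y) {α : ℝ≥0∞}
    (hα : 0 < t → ∫⁻ z, a z * ‖gaussKernel t z‖ₑ ≤ α) :
    ∫⁻ x, w x * ‖heat t φ x‖ₑ ≤ α * (∫⁻ y, ‖φ y‖ₑ) + ∫⁻ y, b y * ‖φ y‖ₑ := by
  rcases ht.eq_or_lt with rfl | ht
  · rw [heat_of_nonpos le_rfl]
    refine le_add_left (lintegral_mono fun x => ?_)
    gcongr
    exact hwb x
  · simp only [heat_of_pos ht]
    refine (lintegral_mul_enorm_conv_le (measurable_gaussKernel t) hφ hw hb hwab).trans ?_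
    rw [lintegral_gaussKernel ht, one_mul]
    gcongr
    exact hα ht

theorem lintegral_enorm_heat_le {t : ℝ} {φ : Rn n → ℝ} (hφ : AEMeasurable φ) :
    ∫⁻ x, ‖heat t φ x‖ₑ ≤ ∫⁻ y, ‖φ y‖ₑ := by
  rcases lt_or_ge 0 t with ht | ht
  · simp only [heat_of_pos ht]
    refine (lintegral_enorm_conv_le (measurable_gaussKernel t) hφ).trans ?_
    rw [lintegral_gaussKernel ht, one_mul]
  · rw [heat_of_nonpos ht]

theorem enorm_heat_le {t : ℝ} (ht : 0 < t) {φ : Rn n → ℝ} {A : ℝ≥0∞} (hA : ∀ᵐ y, ‖φ y‖ₑ ≤ A)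
    (x : Rn n) : ‖heat t φ x‖ₑ ≤ A := by
  rw [heat_of_pos ht]
  refine (enorm_conv_le_of_ae_le (measurable_gaussKernel t) hA x).trans ?_
  rw [lintegral_gaussKernel ht, one_mul]

theorem two_rpow_mul_one_add_rpow {t : ℝ} (ht : 0 ≤ t) :
    (2 : ℝ) ^ ((n : ℝ) / 2) * (1 + t) ^ (-((n : ℝ) / 2)) = ((1 + t) / 2) ^ (-((n : ℝ) / 2)) := by
  rw [Real.div_rpow (by positivity) (by positivity), Real.rpow_neg (x := 2) (by positivity)]
  field_simp

/-- The decay of the heat semigroup from `L¹ ∩ L^∞` to `L^∞`. -/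
theorem enorm_heat_le_decay {t : ℝ} (ht : 0 < t) {φ : Rn n → ℝ} (hφ : AEMeasurable φ) {A : ℝ≥0∞}
    (h1 : ∫⁻ y, ‖φ y‖ₑ ≤ A) (hA : ∀ᵐ y, ‖φ y‖ₑ ≤ A) (x : Rn n) :
    ‖heat t φ x‖ₑ ≤ ENNReal.ofReal (2 ^ ((n : ℝ) / 2) * (1 + t) ^ (-((n : ℝ) / 2))) * A := by
  rw [two_rpow_mul_one_add_rpow ht.le]
  -- The factor `((1+t)/2)^{-n/2}` dominates both available bounds: it is at least `1` for `t ≤ 1`,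
  -- and at least `(4πt)^{-n/2}` for `t ≥ 1`.
  rcases le_total t 1 with h | h
  · refine (enorm_heat_le ht hA x).trans (le_mul_of_one_le_left zero_le ?_)
    rw [ENNReal.one_le_ofReal]
    exact Real.one_le_rpow_of_pos_of_le_one_of_nonpos (by positivity) (by linarith)
      (by simp; positivity)
  · rw [heat_of_pos ht]
    refine (enorm_conv_le_of_kernel_le (c := ENNReal.ofReal ((4 * Real.pi * t) ^ (-((n : ℝ) / 2))))
      (fun z => ?_) hφ x).trans ?_
    · rw [← ofReal_norm]
      exact ENNReal.ofReal_le_ofReal (norm_gaussKernel_le ht z)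
    · gcongr ENNReal.ofReal ?_ * ?_
      refine Real.rpow_le_rpow_of_nonpos (by positivity) ?_ (by simp; positivity)
      nlinarith [Real.pi_gt_three]

/-- Bounds, in `L¹` and in `L^∞`, of differences of the heat semigroup at two times. -/
theorem lintegral_enorm_heat_sub_le {a b : ℝ} (ha : 0 < a) (hb : 0 < b) {φ : Rn n → ℝ}
    (hφ : Integrable φ) :
    ∫⁻ x, ‖heat b φ x - heat a φ x‖ₑ ≤
      (∫⁻ z : Rn n, ‖gaussKernel b z - gaussKernel a z‖ₑ) * ∫⁻ y, ‖φ y‖ₑ := by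
  simp only [heat_time_sub ha hb hφ]
  exact lintegral_enorm_conv_le (k := fun z => gaussKernel b z - gaussKernel a z)
    ((measurable_gaussKernel b).sub (measurable_gaussKernel a)) hφ.1.aemeasurable

theorem enorm_heat_sub_le {a b : ℝ} (ha : 0 < a) (hb : 0 < b) {φ : Rn n → ℝ}
    (hφ : Integrable φ) {A : ℝ≥0∞} (hA : ∀ᵐ y, ‖φ y‖ₑ ≤ A) (x : Rn n) :
    ‖heat b φ x - heat a φ x‖ₑ ≤
      (∫⁻ z : Rn n, ‖gaussKernel b z - gaussKernel a z‖ₑ) * A := by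
  rw [heat_time_sub ha hb hφ]
  exact enorm_conv_le_of_ae_le (k := fun z => gaussKernel b z - gaussKernel a z)
    ((measurable_gaussKernel b).sub (measurable_gaussKernel a)) hA x

theorem tendsto_lintegral_gaussKernel_sub {a : ℝ} (ha : 0 < a) :
    Tendsto (fun b => ∫⁻ z : Rn n, ‖gaussKernel b z - gaussKernel a z‖ₑ) (𝓝 a) (𝓝 0) := by
  have h : Tendsto (fun b => ENNReal.ofReal (2 * ((max a b / min a b) ^ ((n : ℝ) / 2) - 1)))
      (𝓝 a) (𝓝 0) := by
    have : ContinuousAt (fun b => 2 * ((max a b / min a b) ^ ((n : ℝ) / 2) - 1)) a := by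
      refine continuousAt_const.mul (ContinuousAt.sub ?_ continuousAt_const)
      refine ContinuousAt.rpow_const (ContinuousAt.div (by fun_prop) (by fun_prop) ?_) (.inr ?_)
      · simpa using ha.ne'
      · positivity
    have := (ENNReal.continuous_ofReal.tendsto _).comp this.tendsto
    simpa [ha.ne', Function.comp_def] using this
  refine tendsto_of_tendsto_of_tendsto_of_le_of_le' tendsto_const_nhds h
    (Eventually.of_forall fun _ => zero_le) ?_
  filter_upwards [lt_mem_nhds ha] with b hb
  rcases le_total a b with hab | hab
  · rw [max_eq_right hab, min_eq_left hab]
    exact lintegral_gaussKernel_sub_le ha hab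
  · rw [max_eq_left hab, min_eq_right hab]
    refine le_trans (le_of_eq ?_) (lintegral_gaussKernel_sub_le hb hab)
    exact lintegral_congr fun z => enorm_sub_rev _ _

theorem tendsto_heat_time {a : ℝ} (ha : 0 < a) {φ : Rn n → ℝ} (hφ : Integrable φ) (x : Rn n) :
    Tendsto (fun b => heat b φ x) (𝓝 a) (𝓝 (heat a φ x)) := by
  have h : Tendsto (fun b => ∫ y, gaussKernel b (x - y) * φ y) (𝓝 a)
      (𝓝 (∫ y, gaussKernel a (x - y) * φ y)) := by
    refine tendsto_integral_filter_of_dominated_convergence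
      (fun y => (4 * Real.pi * (a / 2)) ^ (-((n : ℝ) / 2)) * ‖φ y‖) ?_ ?_
      (hφ.norm.const_mul _) (ae_of_all _ fun y => ?_)
    · filter_upwards [lt_mem_nhds ha] with b hb
      exact (integrable_gaussKernel_mul hb hφ x).1
    · filter_upwards [lt_mem_nhds (half_lt_self ha)] with b hb
      refine ae_of_all _ fun y => ?_
      rw [norm_mul]
      gcongr
      refine (norm_gaussKernel_le (by linarith) _).trans ?_
      refine Real.rpow_le_rpow_of_nonpos (by positivity) ?_ (by simp; positivity)
      nlinarith [Real.pi_pos]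
    · refine Tendsto.mul_const _ ?_
      have : ContinuousAt (fun b => gaussKernel b (x - y)) a := by
        unfold gaussKernel
        refine ContinuousAt.mul (ContinuousAt.rpow_const (by fun_prop) (.inl (by positivity))) ?_
        exact (ContinuousAt.neg (continuousAt_const.div (by fun_prop) (by positivity))).rexp
      exact this.tendsto
  rw [heat_of_pos ha]
  refine h.congr' ?_
  filter_upwards [lt_mem_nhds ha] with b hb
  rw [heat_of_pos hb]

end

section

variable {n : ℕ}

/-! ### Strong continuity of the heat semigroup on `L¹` at time `0` -/

/-- This is continuity of the translation action on `Lp` for a finite exponent, rewritten in terms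
of representatives. -/
theorem tendsto_lintegral_translate_sub {φ : Rn n → ℝ} (hφ : Integrable φ) :
    Tendsto (fun z => ∫⁻ x, ‖φ (x - z) - φ x‖ₑ) (𝓝 0) (𝓝 0) := by
  have hm : MemLp φ 1 volume := memLp_one_iff_integrable.2 hφ
  have : Fact ((1 : ℝ≥0∞) ≠ ∞) := ⟨ENNReal.one_ne_top⟩
  have hc : Continuous fun z : Rn n => DomAddAct.mk z +ᵥ hm.toLp φ :=
    DomAddAct.continuous_mk.vadd continuous_const
  have h := (hc.comp continuous_neg).tendsto 0
  rw [tendsto_iff_edist_tendsto_0] at h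
  refine h.congr fun z => ?_
  simp only [Function.comp_apply, neg_zero, DomAddAct.mk_zero, zero_vadd]
  rw [DomAddAct.mk_vadd_toLp, Lp.edist_toLp_toLp, eLpNorm_one_eq_lintegral_enorm]
  refine lintegral_congr fun x => ?_
  simp [sub_eq_neg_add]

/-- Since `G_t` has mass one, `e^{tΔ}φ - φ` is the `G_t`-average of `φ(· - z) - φ`. For small `z`
translation is continuous in `L¹`; the remaining `z` carry a vanishing mass of `G_t` and cost at
most `2‖φ‖₁`. The limit is over a full neighbourhood of `0` because `heat t` is the identity for `t
≤ 0`. -/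
theorem tendsto_heat_zero {φ : Rn n → ℝ} (hφ : Integrable φ) :
    Tendsto (fun t => ∫⁻ x, ‖heat t φ x - φ x‖ₑ) (𝓝 0) (𝓝 0) := by
  -- Tonelli needs `(z, x) ↦ φ(x - z)` jointly measurable; replacing `φ` by a Borel representative
  -- changes the difference only on a null set.
  wlog hmeas : Measurable φ generalizing φ
  · obtain ⟨ψ, hψ, hae⟩ := hφ.1.aemeasurable
    refine (this (hφ.congr hae) hψ).congr fun t => lintegral_congr_ae ?_
    filter_upwards [hae] with x hx
    rcases lt_or_ge 0 t with ht | ht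
    · rw [heat_congr_ae ht hae, hx]
    · rw [heat_of_nonpos ht, heat_of_nonpos ht, sub_self, sub_self]
  set τ : Rn n → ℝ≥0∞ := fun z => ∫⁻ x, ‖φ (x - z) - φ x‖ₑ with hτ
  set N := ∫⁻ x, ‖φ x‖ₑ with hN
  have hNtop : N ≠ ∞ := hφ.2.ne
  have hτm : Measurable τ := by
    refine Measurable.lintegral_prod_right' (f := fun q : Rn n × Rn n => ‖φ (q.2 - q.1) - φ q.2‖ₑ) ?_
    fun_prop
  have hτ2 : ∀ z, τ z ≤ 2 * N := fun z => by
    calc τ z ≤ ∫⁻ x, (‖φ (x - z)‖ₑ + ‖φ x‖ₑ) := lintegral_mono fun x => enorm_sub_le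
      _ = 2 * N := by
        rw [lintegral_add_left (by fun_prop), lintegral_sub_right_eq_self (fun x => ‖φ x‖ₑ),
          two_mul]
  have key : ∀ t, 0 < t → ∫⁻ x, ‖heat t φ x - φ x‖ₑ ≤ ∫⁻ z, ‖gaussKernel t z‖ₑ * τ z := by
    intro t ht
    calc ∫⁻ x, ‖heat t φ x - φ x‖ₑ
        ≤ ∫⁻ x, ∫⁻ z, ‖gaussKernel t z‖ₑ * ‖φ (x - z) - φ x‖ₑ := by
          refine lintegral_mono fun x => ?_
          have e : heat t φ x - φ x = ∫ z, gaussKernel t z * (φ (x - z) - φ x) := by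
            have i1 : Integrable fun z => gaussKernel t z * φ (x - z) := by
              have := (integrable_gaussKernel_mul ht hφ x).comp_sub_left x
              simpa using this
            simp only [mul_sub]
            rw [integral_sub i1 ((integrable_gaussKernel ht).mul_const _), integral_mul_const,
              integral_gaussKernel ht, one_mul, heat_of_pos ht,
              ← integral_sub_left_eq_self _ _ x]
            simp
          rw [e]
          refine (enorm_integral_le_lintegral_enorm _).trans (le_of_eq ?_)
          simp only [enorm_mul]
      _ = ∫⁻ z, ∫⁻ x, ‖gaussKernel t z‖ₑ * ‖φ (x - z) - φ x‖ₑ := by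
          refine lintegral_lintegral_swap (Measurable.aemeasurable ?_)
          have := measurable_gaussKernel (n := n) t
          unfold Function.uncurry
          fun_prop
      _ = _ := by
          refine lintegral_congr fun z => ?_
          rw [lintegral_const_mul _ (by fun_prop)]
  rw [ENNReal.tendsto_nhds_zero]
  intro ε hε
  have hε2 : 0 < ε / 2 := ENNReal.half_pos hε.ne'
  obtain ⟨δ, hδ, hδτ⟩ : ∃ δ > 0, ∀ z : Rn n, ‖z‖ < δ → τ z ≤ ε / 2 := by
    have := (ENNReal.tendsto_nhds_zero.1 (tendsto_lintegral_translate_sub hφ)) _ hε2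
    obtain ⟨δ, hδ, h⟩ := Metric.eventually_nhds_iff.1 this
    exact ⟨δ, hδ, fun z hz => h (by simpa using hz)⟩
  -- The mass of `G_t` outside radius `δ/2` is `O(√t/δ)`: the tail bound with `m = 0` uses the first
  -- moment.
  have htail : Tendsto (fun t : ℝ => 2 * N *
      ENNReal.ofReal (momentConst n (0 + 1) * t ^ (((0 + 1 : ℕ) : ℝ) / 2) / (δ / 2))) (𝓝 0)
      (𝓝 0) := by
    have h1 : Tendsto (fun t : ℝ => momentConst n (0 + 1) * t ^ (((0 + 1 : ℕ) : ℝ) / 2) / (δ / 2))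
        (𝓝 0) (𝓝 0) := by
      have : ContinuousAt (fun t : ℝ => momentConst n (0 + 1) * t ^ (((0 + 1 : ℕ) : ℝ) / 2) /
          (δ / 2)) 0 :=
        (continuousAt_const.mul (continuousAt_id.rpow_const (.inr (by positivity)))).div_const _
      simpa [ContinuousAt] using this
    have h2 := (ENNReal.tendsto_ofReal h1)
    have h2N : 2 * N ≠ ∞ := ENNReal.mul_ne_top ENNReal.ofNat_ne_top hNtop
    have := ENNReal.Tendsto.const_mul h2 (a := 2 * N) (.inr h2N)
    simpa using this
  filter_upwards [ENNReal.tendsto_nhds_zero.1 htail _ hε2] with t ht2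
  rcases lt_or_ge 0 t with ht | ht
  · refine (key t ht).trans ?_
    have hS : MeasurableSet {z : Rn n | δ / 2 < ‖z‖} := measurableSet_lt measurable_const measurable_norm
    rw [← ENNReal.add_halves ε, ← lintegral_add_compl _ hS, add_comm]
    refine add_le_add ?_ (le_trans ?_ ht2)
    · calc ∫⁻ z in {z : Rn n | δ / 2 < ‖z‖}ᶜ, ‖gaussKernel t z‖ₑ * τ z
          ≤ ∫⁻ z in {z : Rn n | δ / 2 < ‖z‖}ᶜ, ‖gaussKernel t z‖ₑ * (ε / 2) := by
            refine setLIntegral_mono ((measurable_gaussKernel t).enorm.mul_const _) fun z hz => ?_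
            gcongr
            refine hδτ z ?_
            have : ‖z‖ ≤ δ / 2 := not_lt.1 hz
            linarith
        _ ≤ ∫⁻ z : Rn n, ‖gaussKernel t z‖ₑ * (ε / 2) := setLIntegral_le_lintegral _ _
        _ = ε / 2 := by
            rw [lintegral_mul_const _ (measurable_gaussKernel t).enorm, lintegral_gaussKernel ht,
              one_mul]
    · calc ∫⁻ z in {z : Rn n | δ / 2 < ‖z‖}, ‖gaussKernel t z‖ₑ * τ z
          ≤ ∫⁻ z in {z : Rn n | δ / 2 < ‖z‖}, 2 * N * (‖z‖ₑ ^ 0 * ‖gaussKernel t z‖ₑ) := by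
            refine lintegral_mono fun z => ?_
            rw [pow_zero, one_mul, mul_comm]
            gcongr
            exact hτ2 z
        _ ≤ _ := by
            rw [lintegral_const_mul _ (by have := measurable_gaussKernel (n := n) t; fun_prop)]
            gcongr
            exact lintegral_tail_gaussKernel_le ht (by positivity) 0
  · rw [heat_of_nonpos ht]
    simp

/-- `t ↦ e^{tΔ} φ` is continuous with values in `L¹`. -/
theorem tendsto_lintegral_heat_sub {a : ℝ} (ha : 0 ≤ a) {φ : Rn n → ℝ} (hφ : Integrable φ) :
    Tendsto (fun t => ∫⁻ x, ‖heat t φ x - heat a φ x‖ₑ) (𝓝 a) (𝓝 0) := by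
  rcases ha.eq_or_lt with rfl | ha
  · simpa only [heat_of_nonpos le_rfl] using tendsto_heat_zero hφ
  · have h := ENNReal.Tendsto.mul_const (tendsto_lintegral_gaussKernel_sub (n := n) ha)
      (b := ∫⁻ y, ‖φ y‖ₑ) (.inr hφ.2.ne)
    rw [zero_mul] at h
    refine tendsto_of_tendsto_of_tendsto_of_le_of_le' tendsto_const_nhds h
      (Eventually.of_forall fun _ => zero_le) ?_
    filter_upwards [lt_mem_nhds ha] with b hb
    exact lintegral_enorm_heat_sub_le ha hb hφ

end

section

variable {n : ℕ}

/-! ### The Duhamel integral -/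

/-- A source term: continuous for `s > 0` with values in `L¹`, and bounded by `A` in `L¹` and
in `L^∞`. -/
structure IsSource (A : ℝ≥0) (g : ℝ → Rn n → ℝ) : Prop where
  integrable : ∀ s, 0 < s → Integrable (g s)
  tendsto : ∀ s, 0 < s → Tendsto (fun r => ∫⁻ x, ‖g r x - g s x‖ₑ) (𝓝 s) (𝓝 0)
  lintegral_le : ∀ s, 0 < s → ∫⁻ x, ‖g s x‖ₑ ≤ A
  ae_le : ∀ s, 0 < s → ∀ᵐ x, ‖g s x‖ₑ ≤ A

/-- The Duhamel integral `∫₀ᵗ e^{(t-s)Δ} g(s) ds`. -/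
noncomputable def duhamel (g : ℝ → Rn n → ℝ) (t : ℝ) (x : Rn n) : ℝ :=
  ∫ s in (0 : ℝ)..t, heat (t - s) (g s) x

/-- The integrand of the Duhamel integral, extended by `0`. -/
noncomputable def duhamelIntegrand (g : ℝ → Rn n → ℝ) (t s : ℝ) (x : Rn n) : ℝ :=
  (Set.Ioo 0 t).indicator (fun s => heat (t - s) (g s) x) s

/-- The open interval excludes `s = t`, where `heat 0` does not smooth, and `s = 0`, where a source
is not controlled. The fixed domain `ℝ` lets integrands for different `t` be subtracted. -/
theorem duhamel_eq_integral (g : ℝ → Rn n → ℝ) {t : ℝ} (ht : 0 ≤ t) (x : Rn n) :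
    duhamel g t x = ∫ s, duhamelIntegrand g t s x := by
  unfold duhamel duhamelIntegrand
  rw [intervalIntegral.integral_of_le ht, integral_Ioc_eq_integral_Ioo,
    integral_indicator measurableSet_Ioo]

theorem duhamelIntegrand_of_mem (g : ℝ → Rn n → ℝ) {t s : ℝ} (hs : s ∈ Set.Ioo 0 t) (x : Rn n) :
    duhamelIntegrand g t s x = heat (t - s) (g s) x := Set.indicator_of_mem hs _

theorem duhamelIntegrand_of_notMem (g : ℝ → Rn n → ℝ) {t s : ℝ} (hs : s ∉ Set.Ioo 0 t)
    (x : Rn n) : duhamelIntegrand g t s x = 0 := Set.indicator_of_notMem hs _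

variable {A : ℝ≥0} {g g' : ℝ → Rn n → ℝ}

theorem IsSource.sub {B : ℝ≥0} (hg : IsSource A g) (hg' : IsSource B g') :
    IsSource (A + B) fun s x => g s x - g' s x where
  integrable s hs := (hg.integrable s hs).sub (hg'.integrable s hs)
  tendsto s hs := by
    have h := (hg.tendsto s hs).add (hg'.tendsto s hs)
    rw [add_zero] at h
    refine tendsto_of_tendsto_of_tendsto_of_le_of_le' tendsto_const_nhds h
      (Eventually.of_forall fun _ => zero_le) ?_
    filter_upwards [lt_mem_nhds hs] with r hr
    have hm : AEMeasurable fun x => ‖g r x - g s x‖ₑ :=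
      ((hg.integrable r hr).1.sub (hg.integrable s hs).1).enorm
    rw [← lintegral_add_left' hm]
    refine lintegral_mono fun x => ?_
    rw [show g r x - g' r x - (g s x - g' s x) = (g r x - g s x) - (g' r x - g' s x) by ring]
    exact enorm_sub_le
  lintegral_le s hs := by
    rw [ENNReal.coe_add]
    refine le_trans ?_ (add_le_add (hg.lintegral_le s hs) (hg'.lintegral_le s hs))
    rw [← lintegral_add_left' (hg.integrable s hs).1.enorm]
    exact lintegral_mono fun x => enorm_sub_le
  ae_le s hs := by
    filter_upwards [hg.ae_le s hs, hg'.ae_le s hs] with x h h'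
    rw [ENNReal.coe_add]
    exact enorm_sub_le.trans (add_le_add h h')

/-- Two errors are separated: the source moves in `L¹`, against a kernel bounded as long as its time
stays above `(t - s)/2`; and the kernel moves in time against the fixed source `g s`. -/
theorem IsSource.continuousAt_heat (hg : IsSource A g) {t s : ℝ} (hs : s ∈ Set.Ioo 0 t)
    (x : Rn n) : ContinuousAt (fun r => heat (t - r) (g r) x) s := by
  have hts : 0 < t - s := by linarith [hs.2]
  have h1 : Tendsto (fun r => heat (t - r) (g s) x) (𝓝 s) (𝓝 (heat (t - s) (g s) x)) :=
    (tendsto_heat_time hts (hg.integrable s hs.1) x).comp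
      ((continuous_const.sub continuous_id).tendsto s)
  have h2 : Tendsto (fun r => heat (t - r) (g r) x - heat (t - r) (g s) x) (𝓝 s) (𝓝 0) := by
    rw [tendsto_zero_iff_enorm_tendsto_zero]
    set c := ENNReal.ofReal ((4 * Real.pi * ((t - s) / 2)) ^ (-((n : ℝ) / 2))) with hc
    have h := ENNReal.Tendsto.const_mul (hg.tendsto s hs.1) (a := c) (.inr ENNReal.ofReal_ne_top)
    rw [mul_zero] at h
    refine tendsto_of_tendsto_of_tendsto_of_le_of_le' tendsto_const_nhds h
      (Eventually.of_forall fun _ => zero_le) ?_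
    filter_upwards [lt_mem_nhds hs.1, gt_mem_nhds (show s < s + (t - s) / 2 by linarith)]
      with r hr hr'
    have hi := (hg.integrable r hr).sub (hg.integrable s hs.1)
    rw [heat_sub (hg.integrable r hr) (hg.integrable s hs.1), heat_of_pos (by linarith)]
    refine enorm_conv_le_of_kernel_le (fun z => ?_) hi.1.aemeasurable x
    rw [← ofReal_norm]
    refine ENNReal.ofReal_le_ofReal ((norm_gaussKernel_le (by linarith) z).trans ?_)
    refine Real.rpow_le_rpow_of_nonpos (by positivity) ?_ (by simp; positivity)
    have := Real.pi_pos
    gcongr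
    linarith
  have := h2.add h1
  simpa [ContinuousAt] using this

/-- A Carathéodory argument: the integrand is continuous in `x` for each `s` and measurable in `s`
for each `x`. Joint measurability of `g` is never assumed, which matters because `g s` is an
arbitrary representative for each `s`. -/
theorem IsSource.measurable_duhamelIntegrand (hg : IsSource A g) (t : ℝ) :
    Measurable fun q : ℝ × Rn n => duhamelIntegrand g t q.1 q.2 := by
  have h : Measurable (Function.uncurry fun (x : Rn n) (s : ℝ) => duhamelIntegrand g t s x) := by
    refine measurable_uncurry_of_continuous_of_measurable (fun s => ?_) fun x => ?_
    · by_cases hs : s ∈ Set.Ioo 0 t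
      · simp only [duhamelIntegrand_of_mem g hs]
        exact continuous_heat (by linarith [hs.2]) (hg.integrable s hs.1)
      · simp only [duhamelIntegrand_of_notMem g hs]
        exact continuous_const
    · classical
      unfold duhamelIntegrand
      rw [← Set.piecewise_eq_indicator]
      refine ContinuousOn.measurable_piecewise (fun s hs => ?_) continuousOn_const
        measurableSet_Ioo
      exact (hg.continuousAt_heat hs x).continuousWithinAt
  exact h.comp measurable_swap

theorem IsSource.measurable_duhamelIntegrand_left (hg : IsSource A g) (t : ℝ) (x : Rn n) :
    Measurable fun s => duhamelIntegrand g t s x := by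
  have h : Measurable (Function.uncurry (duhamelIntegrand g t)) := hg.measurable_duhamelIntegrand t
  exact h.of_uncurry_right

theorem IsSource.integrable_duhamelIntegrand (hg : IsSource A g) (t : ℝ) (x : Rn n) :
    Integrable fun s => duhamelIntegrand g t s x := by
  have hi : Integrable ((Set.Ioo 0 t).indicator fun _ : ℝ => (A : ℝ)) :=
    (integrable_indicator_iff measurableSet_Ioo).2 (integrableOn_const (by simp))
  refine hi.mono' (hg.measurable_duhamelIntegrand_left t x).aestronglyMeasurable
    (ae_of_all _ fun s => ?_)
  by_cases hs : s ∈ Set.Ioo 0 t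
  · rw [duhamelIntegrand_of_mem g hs, Set.indicator_of_mem hs]
    have := enorm_heat_le (t := t - s) (by linarith [hs.2]) (hg.ae_le s hs.1) x
    rw [enorm_eq_nnnorm] at this
    exact_mod_cast this
  · rw [duhamelIntegrand_of_notMem g hs, Set.indicator_of_notMem hs, norm_zero]

theorem IsSource.measurable_duhamel (hg : IsSource A g) {t : ℝ} (ht : 0 ≤ t) :
    Measurable (duhamel g t) := by
  have : duhamel g t = fun x => ∫ s, duhamelIntegrand g t s x :=
    funext fun x => duhamel_eq_integral g ht x
  rw [this]
  exact ((hg.measurable_duhamelIntegrand t).stronglyMeasurable.integral_prod_left').measurable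

theorem IsSource.duhamel_sub (hg : IsSource A g) {B : ℝ≥0} (hg' : IsSource B g') {t : ℝ}
    (ht : 0 ≤ t) (x : Rn n) :
    duhamel g t x - duhamel g' t x = duhamel (fun s x => g s x - g' s x) t x := by
  rw [duhamel_eq_integral g ht, duhamel_eq_integral g' ht, duhamel_eq_integral _ ht,
    ← integral_sub (hg.integrable_duhamelIntegrand t x) (hg'.integrable_duhamelIntegrand t x)]
  refine integral_congr_ae (ae_of_all _ fun s => ?_)
  by_cases hs : s ∈ Set.Ioo 0 t
  · simp only [duhamelIntegrand_of_mem _ hs]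
    exact heat_sub (hg.integrable s hs.1) (hg'.integrable s hs.1) x
  · simp only [duhamelIntegrand_of_notMem _ hs, sub_zero]

theorem enorm_duhamelIntegrand (g : ℝ → Rn n → ℝ) (t s : ℝ) (x : Rn n) :
    ‖duhamelIntegrand g t s x‖ₑ =
      (Set.Ioo 0 t).indicator (fun s => ‖heat (t - s) (g s) x‖ₑ) s := by
  by_cases hs : s ∈ Set.Ioo 0 t
  · rw [duhamelIntegrand_of_mem g hs, Set.indicator_of_mem hs]
  · rw [duhamelIntegrand_of_notMem g hs, Set.indicator_of_notMem hs, enorm_zero]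

theorem enorm_duhamel_le (g : ℝ → Rn n → ℝ) {t : ℝ} (ht : 0 ≤ t) (x : Rn n) :
    ‖duhamel g t x‖ₑ ≤ ∫⁻ s in Set.Ioo 0 t, ‖heat (t - s) (g s) x‖ₑ := by
  rw [duhamel_eq_integral g ht, ← lintegral_indicator measurableSet_Ioo]
  refine (enorm_integral_le_lintegral_enorm _).trans (le_of_eq ?_)
  exact lintegral_congr fun s => enorm_duhamelIntegrand g t s x

theorem IsSource.lintegral_mul_enorm_duhamel_le (hg : IsSource A g) {t : ℝ} (ht : 0 ≤ t)
    {w : Rn n → ℝ≥0∞} (hw : Measurable w) :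
    ∫⁻ x, w x * ‖duhamel g t x‖ₑ ≤
      ∫⁻ s in Set.Ioo 0 t, ∫⁻ x, w x * ‖heat (t - s) (g s) x‖ₑ := by
  calc ∫⁻ x, w x * ‖duhamel g t x‖ₑ
      ≤ ∫⁻ x, ∫⁻ s, w x * ‖duhamelIntegrand g t s x‖ₑ := by
        refine lintegral_mono fun x => ?_
        rw [lintegral_const_mul _ (hg.measurable_duhamelIntegrand_left t x).enorm,
          duhamel_eq_integral g ht]
        gcongr
        exact enorm_integral_le_lintegral_enorm _
    _ = ∫⁻ s, ∫⁻ x, w x * ‖duhamelIntegrand g t s x‖ₑ := by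
        refine lintegral_lintegral_swap (Measurable.aemeasurable ?_)
        exact (hw.comp measurable_fst).mul
          ((hg.measurable_duhamelIntegrand t).comp measurable_swap).enorm
    _ = _ := by
        rw [← lintegral_indicator measurableSet_Ioo]
        refine lintegral_congr fun s => ?_
        by_cases hs : s ∈ Set.Ioo 0 t
        · simp only [duhamelIntegrand_of_mem g hs, Set.indicator_of_mem hs]
        · simp [duhamelIntegrand_of_notMem g hs, Set.indicator_of_notMem hs]

/-! ### Continuity in time of the Duhamel integral -/

/-- A pointwise majorant in `s` of `‖G_{t'-s} - G_{t-s}‖₁`. -/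
noncomputable def timeMajorant (n : ℕ) (t t' s : ℝ) : ℝ≥0∞ :=
  (Set.Ioo (t - √(t' - t)) t').indicator (fun _ => 2) s +
    (Set.Ioo 0 t).indicator
      (fun _ => ENNReal.ofReal (2 * ((1 + √(t' - t)) ^ ((n : ℝ) / 2) - 1))) s

/-- The modulus of continuity in time of the Duhamel integral on `[0, T]`. -/
noncomputable def timeModulus (n : ℕ) (T h : ℝ) : ℝ≥0∞ :=
  ENNReal.ofReal (√h + h) * 2 +
    ENNReal.ofReal T * ENNReal.ofReal (2 * ((1 + √h) ^ ((n : ℝ) / 2) - 1))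

theorem lintegral_timeMajorant_le {t t' T : ℝ} (htT : t ≤ T) :
    ∫⁻ s, timeMajorant n t t' s ≤ timeModulus n T (t' - t) := by
  unfold timeMajorant timeModulus
  rw [lintegral_add_left (measurable_const.indicator measurableSet_Ioo),
    lintegral_indicator measurableSet_Ioo, lintegral_indicator measurableSet_Ioo,
    setLIntegral_const, setLIntegral_const, Real.volume_Ioo, Real.volume_Ioo, mul_comm 2,
    mul_comm (ENNReal.ofReal (2 * _)), show t' - (t - √(t' - t)) = √(t' - t) + (t' - t) by ring,
    sub_zero]
  gcongr

theorem tendsto_timeModulus (n : ℕ) (T : ℝ) : Tendsto (timeModulus n T) (𝓝 0) (𝓝 0) := by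
  have h1 : Tendsto (fun h : ℝ => ENNReal.ofReal (√h + h)) (𝓝 0) (𝓝 0) := by
    have := (ENNReal.continuous_ofReal.comp (Real.continuous_sqrt.add continuous_id)).tendsto 0
    simpa [Function.comp_def] using this
  have h2 : Tendsto (fun h : ℝ => ENNReal.ofReal (2 * ((1 + √h) ^ ((n : ℝ) / 2) - 1))) (𝓝 0)
      (𝓝 0) := by
    have hc : Continuous fun h : ℝ => 2 * ((1 + √h) ^ ((n : ℝ) / 2) - 1) :=
      continuous_const.mul (((continuous_const.add Real.continuous_sqrt).rpow_const
        fun x => .inr (by positivity)).sub continuous_const)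
    have := (ENNReal.continuous_ofReal.comp hc).tendsto 0
    simpa [Function.comp_def] using this
  have := (ENNReal.Tendsto.mul_const h1 (b := 2) (.inr (ENNReal.ofNat_ne_top (n := 2)))).add
    (ENNReal.Tendsto.const_mul h2 (a := ENNReal.ofReal T) (.inr ENNReal.ofReal_ne_top))
  simp only [zero_mul, mul_zero, add_zero] at this
  exact this

/-- With `h = t' - t`, the cut is at distance `√h` from `t`. Farther away, the ratio of times is `1
+ h/(t-s) ≤ 1 + √h`; nearer, the trivial bound `2` is used, on an interval of length at most `√h +
h`. -/
theorem lintegral_gaussKernel_sub_le_timeMajorant {t t' s : ℝ} (htt' : t ≤ t')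
    (hs : s ∈ Set.Ioo 0 t) :
    ∫⁻ z : Rn n, ‖gaussKernel (t' - s) z - gaussKernel (t - s) z‖ₑ ≤ timeMajorant n t t' s := by
  have h1 : 0 < t - s := by linarith [hs.2]
  have h2 : 0 < t' - s := by linarith
  unfold timeMajorant
  by_cases h : t - √(t' - t) < s
  · refine le_add_right ?_
    have hm : s ∈ Set.Ioo (t - √(t' - t)) t' := ⟨h, by linarith [hs.2]⟩
    rw [Set.indicator_of_mem hm]
    exact lintegral_gaussKernel_sub_le_two h1 h2
  · refine le_add_left ?_
    rw [Set.indicator_of_mem hs]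
    refine (lintegral_gaussKernel_sub_le h1 (by linarith)).trans (ENNReal.ofReal_le_ofReal ?_)
    have : (t' - s) / (t - s) ≤ 1 + √(t' - t) := by
      rw [div_le_iff₀ h1]
      have h3 : √(t' - t) ≤ t - s := by linarith
      have h4 : √(t' - t) * √(t' - t) = t' - t := Real.mul_self_sqrt (by linarith)
      nlinarith [Real.sqrt_nonneg (t' - t)]
    gcongr

/-- For `t ≤ s < t'` only the later integrand is present, and it is bounded by the source itself. -/
theorem one_le_timeMajorant {t t' s : ℝ} (h : t ≤ s) (h' : s < t') :
    1 ≤ timeMajorant n t t' s := by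
  unfold timeMajorant
  refine le_add_right ?_
  have : 0 < √(t' - t) := Real.sqrt_pos.2 (by linarith)
  have hm : s ∈ Set.Ioo (t - √(t' - t)) t' := ⟨by linarith, h'⟩
  rw [Set.indicator_of_mem hm]
  exact one_le_two

theorem IsSource.enorm_duhamelIntegrand_sub_le (hg : IsSource A g) {t t' : ℝ} (htt' : t ≤ t')
    (s : ℝ) (x : Rn n) :
    ‖duhamelIntegrand g t' s x - duhamelIntegrand g t s x‖ₑ ≤ timeMajorant n t t' s * A := by
  by_cases h1 : s ∈ Set.Ioo 0 t
  · have h2 : s ∈ Set.Ioo 0 t' := ⟨h1.1, h1.2.trans_le htt'⟩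
    rw [duhamelIntegrand_of_mem g h1, duhamelIntegrand_of_mem g h2]
    refine (enorm_heat_sub_le (by linarith [h1.2]) (by linarith [h2.2]) (hg.integrable s h1.1)
      (hg.ae_le s h1.1) x).trans ?_
    gcongr
    exact lintegral_gaussKernel_sub_le_timeMajorant htt' h1
  · rw [duhamelIntegrand_of_notMem g h1, sub_zero]
    by_cases h2 : s ∈ Set.Ioo 0 t'
    · rw [duhamelIntegrand_of_mem g h2]
      refine (enorm_heat_le (by linarith [h2.2]) (hg.ae_le s h2.1) x).trans ?_
      refine le_mul_of_one_le_left zero_le (one_le_timeMajorant ?_ h2.2)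
      by_contra hlt
      exact h1 ⟨h2.1, not_le.1 hlt⟩
    · rw [duhamelIntegrand_of_notMem g h2, enorm_zero]
      exact zero_le

theorem IsSource.lintegral_enorm_duhamelIntegrand_sub_le (hg : IsSource A g) {t t' : ℝ}
    (htt' : t ≤ t') (s : ℝ) :
    ∫⁻ x, ‖duhamelIntegrand g t' s x - duhamelIntegrand g t s x‖ₑ ≤ timeMajorant n t t' s * A := by
  by_cases h1 : s ∈ Set.Ioo 0 t
  · have h2 : s ∈ Set.Ioo 0 t' := ⟨h1.1, h1.2.trans_le htt'⟩
    simp only [duhamelIntegrand_of_mem g h1, duhamelIntegrand_of_mem g h2]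
    refine (lintegral_enorm_heat_sub_le (by linarith [h1.2]) (by linarith [h2.2])
      (hg.integrable s h1.1)).trans ?_
    gcongr
    · exact lintegral_gaussKernel_sub_le_timeMajorant htt' h1
    · exact hg.lintegral_le s h1.1
  · simp only [duhamelIntegrand_of_notMem g h1, sub_zero]
    by_cases h2 : s ∈ Set.Ioo 0 t'
    · simp only [duhamelIntegrand_of_mem g h2]
      refine (lintegral_enorm_heat_le (hg.integrable s h2.1).1.aemeasurable).trans
        ((hg.lintegral_le s h2.1).trans ?_)
      refine le_mul_of_one_le_left zero_le (one_le_timeMajorant ?_ h2.2)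
      by_contra hlt
      exact h1 ⟨h2.1, not_le.1 hlt⟩
    · simp only [duhamelIntegrand_of_notMem g h2, enorm_zero, lintegral_zero]
      exact zero_le

theorem measurable_timeMajorant (t t' : ℝ) : Measurable (timeMajorant n t t') :=
  (measurable_const.indicator measurableSet_Ioo).add (measurable_const.indicator measurableSet_Ioo)

theorem IsSource.enorm_duhamel_time_sub_le_lintegral (hg : IsSource A g) {t t' : ℝ} (ht : 0 ≤ t)
    (htt' : t ≤ t') (x : Rn n) :
    ‖duhamel g t' x - duhamel g t x‖ₑ ≤
      ∫⁻ s, ‖duhamelIntegrand g t' s x - duhamelIntegrand g t s x‖ₑ := by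
  rw [duhamel_eq_integral g ht, duhamel_eq_integral g (ht.trans htt'), ← integral_sub
    (hg.integrable_duhamelIntegrand t' x) (hg.integrable_duhamelIntegrand t x)]
  exact enorm_integral_le_lintegral_enorm _

theorem IsSource.enorm_duhamel_time_sub_le (hg : IsSource A g) {t t' T : ℝ} (ht : 0 ≤ t)
    (htt' : t ≤ t') (htT : t ≤ T) (x : Rn n) :
    ‖duhamel g t' x - duhamel g t x‖ₑ ≤ timeModulus n T (t' - t) * A := by
  refine (hg.enorm_duhamel_time_sub_le_lintegral ht htt' x).trans ?_
  refine (lintegral_mono fun s => hg.enorm_duhamelIntegrand_sub_le htt' s x).trans ?_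
  rw [lintegral_mul_const _ (measurable_timeMajorant t t')]
  gcongr
  exact lintegral_timeMajorant_le htT

theorem IsSource.lintegral_enorm_duhamel_time_sub_le (hg : IsSource A g) {t t' T : ℝ}
    (ht : 0 ≤ t) (htt' : t ≤ t') (htT : t ≤ T) :
    ∫⁻ x, ‖duhamel g t' x - duhamel g t x‖ₑ ≤ timeModulus n T (t' - t) * A := by
  refine (lintegral_mono fun x => hg.enorm_duhamel_time_sub_le_lintegral ht htt' x).trans ?_
  rw [lintegral_lintegral_swap (Measurable.aemeasurable ?_)]
  · refine (lintegral_mono fun s => hg.lintegral_enorm_duhamelIntegrand_sub_le htt' s).trans ?_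
    rw [lintegral_mul_const _ (measurable_timeMajorant t t')]
    gcongr
    exact lintegral_timeMajorant_le htT
  · exact (((hg.measurable_duhamelIntegrand t').comp measurable_swap).sub
      ((hg.measurable_duhamelIntegrand t).comp measurable_swap)).enorm

theorem tendsto_timeModulus_mul (n : ℕ) (t : ℝ) (A : ℝ≥0) :
    Tendsto (fun r => timeModulus n (t + 1) |r - t| * A) (𝓝 t) (𝓝 0) := by
  have h1 : Tendsto (fun r => |r - t|) (𝓝 t) (𝓝 0) := by
    have : Continuous fun r => |r - t| := by fun_prop
    simpa using this.tendsto t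
  have := ENNReal.Tendsto.mul_const ((tendsto_timeModulus n (t + 1)).comp h1) (b := (A : ℝ≥0∞))
    (.inr ENNReal.coe_ne_top)
  simpa [Function.comp_def] using this

theorem IsSource.tendsto_lintegral_duhamel (hg : IsSource A g) {t : ℝ} (ht : 0 ≤ t) :
    Tendsto (fun r => ∫⁻ x, ‖duhamel g r x - duhamel g t x‖ₑ) (𝓝[Set.Ici 0] t) (𝓝 0) := by
  refine tendsto_of_tendsto_of_tendsto_of_le_of_le' tendsto_const_nhds
    ((tendsto_timeModulus_mul n t A).mono_left nhdsWithin_le_nhds)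
    (Eventually.of_forall fun _ => zero_le) ?_
  filter_upwards [self_mem_nhdsWithin] with r hr
  rcases le_total t r with h | h
  · rw [abs_of_nonneg (by linarith)]
    exact hg.lintegral_enorm_duhamel_time_sub_le ht h (by linarith)
  · rw [abs_of_nonpos (by linarith), neg_sub]
    refine le_trans (le_of_eq ?_)
      (hg.lintegral_enorm_duhamel_time_sub_le (T := t + 1) hr h (by linarith))
    exact lintegral_congr fun x => enorm_sub_rev _ _

theorem IsSource.tendsto_iSup_duhamel (hg : IsSource A g) {t : ℝ} (ht : 0 ≤ t) :
    Tendsto (fun r => ⨆ x, ‖duhamel g r x - duhamel g t x‖ₑ) (𝓝[Set.Ici 0] t) (𝓝 0) := by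
  refine tendsto_of_tendsto_of_tendsto_of_le_of_le' tendsto_const_nhds
    ((tendsto_timeModulus_mul n t A).mono_left nhdsWithin_le_nhds)
    (Eventually.of_forall fun _ => zero_le) ?_
  filter_upwards [self_mem_nhdsWithin] with r hr
  refine iSup_le fun x => ?_
  rcases le_total t r with h | h
  · rw [abs_of_nonneg (by linarith)]
    exact hg.enorm_duhamel_time_sub_le ht h (by linarith) x
  · rw [abs_of_nonpos (by linarith), neg_sub, enorm_sub_rev]
    exact hg.enorm_duhamel_time_sub_le (T := t + 1) hr h (by linarith) x

end

section

variable {n : ℕ}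

/-! ### An integral Gronwall inequality -/

theorem lintegral_ofReal_eq_sub {b B : ℝ → ℝ} (hB : ∀ s, 0 ≤ s → HasDerivAt B (b s) s)
    (hb : ContinuousOn b (Set.Ici 0)) (hb0 : ∀ s, 0 ≤ s → 0 ≤ b s) {t : ℝ} (ht : 0 ≤ t) :
    ∫⁻ s in Set.Ioo 0 t, ENNReal.ofReal (b s) = ENNReal.ofReal (B t - B 0) := by
  have hi : IntervalIntegrable b volume 0 t :=
    (hb.mono (by rw [Set.uIcc_of_le ht]; exact Set.Icc_subset_Ici_self)).intervalIntegrable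
  rw [← intervalIntegral.integral_eq_sub_of_hasDerivAt (f' := b)
    (fun s hs => hB s (by rw [Set.uIcc_of_le ht] at hs; exact hs.1)) hi,
    intervalIntegral.integral_of_le ht, integral_Ioc_eq_integral_Ioo,
    ofReal_integral_eq_lintegral_ofReal]
  · exact ((intervalIntegrable_iff_integrableOn_Ioc_of_le ht).1 hi).mono_set Set.Ioo_subset_Ioc_self
  · exact (ae_restrict_iff' measurableSet_Ioo).2 (ae_of_all _ fun s hs => hb0 s hs.1.le)

/-- Let `S` be the supremum of `F / exp(2B)`. As `∫ b exp(2B) ≤ exp(2B)/2`, the hypothesis gives `S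
≤ A + S/2`. This form needs neither continuity nor measurability of `F`; the bound `M` is there only
to make `S` finite and does not enter the conclusion. -/
theorem lintegral_gronwall {b B : ℝ → ℝ} (hB : ∀ s, 0 ≤ s → HasDerivAt B (b s) s)
    (hb : ContinuousOn b (Set.Ici 0)) (hb0 : ∀ s, 0 ≤ s → 0 ≤ b s)
    (hB1 : ∀ s, 0 ≤ s → 0 ≤ B s) {T : ℝ} {F : ℝ → ℝ≥0∞} {A M : ℝ≥0∞} (hM : M ≠ ∞)
    (hFM : ∀ t ∈ Set.Icc 0 T, F t ≤ M)
    (hF : ∀ t ∈ Set.Icc 0 T, F t ≤ A + ∫⁻ s in Set.Ioo 0 t, ENNReal.ofReal (b s) * F s) :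
    ∀ t ∈ Set.Icc 0 T, F t ≤ 2 * A * ENNReal.ofReal (Real.exp (2 * B t)) := by
  set e : ℝ → ℝ≥0∞ := fun t => ENNReal.ofReal (Real.exp (2 * B t)) with he
  have he1 : ∀ t, 0 ≤ t → 1 ≤ e t := fun t ht => by
    rw [he, ENNReal.one_le_ofReal]
    exact Real.one_le_exp (by linarith [hB1 t ht])
  have hetop : ∀ t, e t ≠ ∞ := fun t => ENNReal.ofReal_ne_top
  have he0 : ∀ t, e t ≠ 0 := fun t => by simp [he, Real.exp_pos]
  set S : ℝ≥0∞ := ⨆ t ∈ Set.Icc 0 T, F t / e t with hS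
  have hSM : S ≤ M := iSup₂_le fun t ht =>
    (ENNReal.div_le_of_le_mul ((hFM t ht).trans (le_mul_of_one_le_right zero_le (he1 t ht.1))))
  have hFS : ∀ t ∈ Set.Icc 0 T, F t ≤ S * e t := fun t ht => by
    rw [← ENNReal.div_le_iff (he0 t) (hetop t)]
    exact le_iSup₂ (f := fun t (_ : t ∈ Set.Icc 0 T) => F t / e t) t ht
  have hexp : ∀ s, 0 ≤ s → HasDerivAt (fun s => Real.exp (2 * B s) / 2)
      (b s * Real.exp (2 * B s)) s := fun s hs => by
    refine (((hB s hs).const_mul 2).exp.div_const 2).congr_deriv ?_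
    ring
  have hBc : ContinuousOn B (Set.Ici 0) := fun s hs => (hB s hs).continuousAt.continuousWithinAt
  have hint : ∀ t, 0 ≤ t → ∫⁻ s in Set.Ioo 0 t, ENNReal.ofReal (b s) * e s ≤ e t / 2 := by
    intro t ht
    have h := lintegral_ofReal_eq_sub hexp
      (hb.mul (Real.continuous_exp.comp_continuousOn (continuousOn_const.mul hBc)))
      (fun s hs => mul_nonneg (hb0 s hs) (Real.exp_pos _).le) ht
    have h2 : ∫⁻ s in Set.Ioo 0 t, ENNReal.ofReal (b s) * e s =
        ∫⁻ s in Set.Ioo 0 t, ENNReal.ofReal (b s * Real.exp (2 * B s)) :=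
      setLIntegral_congr_fun measurableSet_Ioo fun s hs => (ENNReal.ofReal_mul (hb0 s hs.1.le)).symm
    rw [h2, h, he, ← ENNReal.ofReal_ofNat, ← ENNReal.ofReal_div_of_pos two_pos]
    refine ENNReal.ofReal_le_ofReal ?_
    linarith [Real.exp_pos (2 * B 0)]
  have hSA : S ≤ A + S / 2 := by
    refine iSup₂_le fun t ht => ENNReal.div_le_of_le_mul ((hF t ht).trans ?_)
    rw [add_mul]
    refine add_le_add (le_mul_of_one_le_right zero_le (he1 t ht.1)) ?_
    calc ∫⁻ s in Set.Ioo 0 t, ENNReal.ofReal (b s) * F s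
        ≤ ∫⁻ s in Set.Ioo 0 t, S * (ENNReal.ofReal (b s) * e s) := by
          refine setLIntegral_mono' measurableSet_Ioo fun s hs => ?_
          rw [mul_left_comm]
          gcongr
          exact hFS s ⟨hs.1.le, hs.2.le.trans ht.2⟩
      _ = S * ∫⁻ s in Set.Ioo 0 t, ENNReal.ofReal (b s) * e s :=
          lintegral_const_mul' _ _ (ne_top_of_le_ne_top hM hSM)
      _ ≤ S * (e t / 2) := by gcongr; exact hint t ht.1
      _ = S / 2 * e t := by simp only [div_eq_mul_inv]; ring
  -- In `ℝ≥0∞`, absorbing `S/2` is legitimate only because `S` is finite.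
  have hS2 : S / 2 ≤ A := by
    have htop : S / 2 ≠ ∞ := ne_top_of_le_ne_top (ne_top_of_le_ne_top hM hSM) ENNReal.half_le_self
    exact (ENNReal.add_le_add_iff_right htop).1 ((ENNReal.add_halves S).trans_le hSA)
  intro t ht
  refine (hFS t ht).trans ?_
  gcongr
  rwa [ENNReal.div_le_iff (by norm_num) (by norm_num), mul_comm] at hS2

/-! ### Decay rates -/

/-- The primitive of `s ↦ (1 + s)^{-σ}` that vanishes at `0`. -/
noncomputable def decayPrimitive (σ s : ℝ) : ℝ := (1 - (1 + s) ^ (1 - σ)) / (σ - 1)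

theorem hasDerivAt_decayPrimitive {σ : ℝ} (hσ : 1 < σ) {s : ℝ} (hs : 0 ≤ s) :
    HasDerivAt (decayPrimitive σ) ((1 + s) ^ (-σ)) s := by
  have h1 : HasDerivAt (fun s : ℝ => 1 + s) 1 s := (hasDerivAt_id s).const_add 1
  have h2 := h1.rpow_const (p := 1 - σ) (.inl (by positivity))
  have h3 := (h2.const_sub 1).div_const (σ - 1)
  refine h3.congr_deriv ?_
  have : σ - 1 ≠ 0 := by linarith
  rw [show 1 - σ - 1 = -σ by ring]
  field_simp
  ring

theorem continuousOn_decay (σ : ℝ) : ContinuousOn (fun s : ℝ => (1 + s) ^ (-σ)) (Set.Ici 0) :=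
  (continuousOn_const.add continuousOn_id).rpow_const fun s hs =>
    .inl (by have : (0 : ℝ) ≤ s := hs; exact (by positivity : 1 + s ≠ 0))

theorem decayPrimitive_zero (σ : ℝ) : decayPrimitive σ 0 = 0 := by simp [decayPrimitive]

theorem decayPrimitive_nonneg {σ : ℝ} (hσ : 1 < σ) {s : ℝ} (hs : 0 ≤ s) :
    0 ≤ decayPrimitive σ s := by
  refine div_nonneg (sub_nonneg.2 ?_) (by linarith)
  exact Real.rpow_le_one_of_one_le_of_nonpos (by linarith) (by linarith)

theorem decayPrimitive_le {σ : ℝ} (hσ : 1 < σ) {s : ℝ} (hs : 0 ≤ s) :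
    decayPrimitive σ s ≤ 1 / (σ - 1) := by
  have : 0 < σ - 1 := by linarith
  unfold decayPrimitive
  gcongr
  have : 0 ≤ (1 + s) ^ (1 - σ) := by positivity
  linarith

theorem lintegral_decay_le {σ : ℝ} (hσ : 1 < σ) {t : ℝ} (ht : 0 ≤ t) :
    ∫⁻ s in Set.Ioo 0 t, ENNReal.ofReal ((1 + s) ^ (-σ)) ≤ ENNReal.ofReal (1 / (σ - 1)) := by
  rw [lintegral_ofReal_eq_sub (fun s hs => hasDerivAt_decayPrimitive hσ hs) (continuousOn_decay σ)
    (fun s hs => by positivity) ht, decayPrimitive_zero, sub_zero]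
  exact ENNReal.ofReal_le_ofReal (decayPrimitive_le hσ ht)

/-- Applied with `r = 1 + (t - s)` when `s ≤ t/2` and with `r = 1 + s` when `s ≥ t/2`. -/
theorem half_rpow_le {t r : ℝ} (ht : 0 ≤ t) (hr : (1 + t) / 2 ≤ r) :
    r ^ (-((n : ℝ) / 2)) ≤ 2 ^ ((n : ℝ) / 2) * (1 + t) ^ (-((n : ℝ) / 2)) := by
  rw [two_rpow_mul_one_add_rpow ht]
  exact Real.rpow_le_rpow_of_nonpos (by positivity) hr (by simp; positivity)

theorem two_rpow_half_mul_self (n : ℕ) :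
    (2 : ℝ) ^ ((n : ℝ) / 2) * 2 ^ ((n : ℝ) / 2) = 2 ^ n := by
  rw [← Real.rpow_add two_pos, add_halves, Real.rpow_natCast]

theorem two_rpow_half_le (n : ℕ) : (2 : ℝ) ^ ((n : ℝ) / 2) ≤ 2 ^ n := by
  rw [← two_rpow_half_mul_self]
  exact le_mul_of_one_le_left (by positivity) (Real.one_le_rpow one_le_two (by positivity))

variable {A : ℝ≥0} {g : ℝ → Rn n → ℝ}

theorem IsSource.lintegral_enorm_duhamel_le (hg : IsSource A g) {t : ℝ} (ht : 0 ≤ t)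
    {a : ℝ → ℝ≥0∞} (ha : ∀ s ∈ Set.Ioo 0 t, ∫⁻ x, ‖g s x‖ₑ ≤ a s) :
    ∫⁻ x, ‖duhamel g t x‖ₑ ≤ ∫⁻ s in Set.Ioo 0 t, a s := by
  have h := hg.lintegral_mul_enorm_duhamel_le ht (w := fun _ => 1) measurable_const
  simp only [one_mul] at h
  refine h.trans (setLIntegral_mono' measurableSet_Ioo fun s hs => ?_)
  exact (lintegral_enorm_heat_le (hg.integrable s hs.1).1.aemeasurable).trans (ha s hs)

theorem IsSource.lintegral_enorm_duhamel_le_of_decay (hg : IsSource A g) {σ : ℝ} (hσ : 1 < σ)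
    {B : ℝ} (hB : 0 ≤ B)
    (h1 : ∀ s, 0 < s → ∫⁻ x, ‖g s x‖ₑ ≤ ENNReal.ofReal (B * (1 + s) ^ (-σ)))
    {t : ℝ} (ht : 0 ≤ t) :
    ∫⁻ x, ‖duhamel g t x‖ₑ ≤ ENNReal.ofReal (B * (1 / (σ - 1))) := by
  refine (hg.lintegral_enorm_duhamel_le ht fun s hs => h1 s hs.1).trans ?_
  simp only [ENNReal.ofReal_mul hB]
  rw [lintegral_const_mul' _ _ ENNReal.ofReal_ne_top]
  gcongr
  exact lintegral_decay_le hσ ht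

/-- For `s ≤ t/2` the semigroup acts for a time at least `t/2`, and its smoothing supplies
`(1+t)^{-n/2}`. For `s ≥ t/2` the source already has this decay and the maximum principle suffices.
In both cases `(1+s)^{-σ}` is left over and is integrable. -/
theorem IsSource.enorm_duhamel_le_of_decay (hg : IsSource A g) {σ : ℝ} (hσ : 1 < σ)
    {B : ℝ} (hB : 0 ≤ B)
    (h1 : ∀ s, 0 < s → ∫⁻ x, ‖g s x‖ₑ ≤ ENNReal.ofReal (B * (1 + s) ^ (-σ)))
    (h2 : ∀ s, 0 < s → ∀ᵐ x, ‖g s x‖ₑ ≤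
      ENNReal.ofReal (B * (1 + s) ^ (-σ) * (1 + s) ^ (-((n : ℝ) / 2))))
    {t : ℝ} (ht : 0 ≤ t) (x : Rn n) :
    ‖duhamel g t x‖ₑ ≤
      ENNReal.ofReal (2 ^ n * (B * (1 / (σ - 1))) * (1 + t) ^ (-((n : ℝ) / 2))) := by
  set d : ℝ → ℝ := fun s => (1 + s) ^ (-((n : ℝ) / 2)) with hd
  set c : ℝ := (2 : ℝ) ^ ((n : ℝ) / 2) with hc
  have hc0 : 0 < c := by positivity
  have hcc : c * c = 2 ^ n := two_rpow_half_mul_self n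
  have hdt : 0 ≤ d t := by simp only [hd]; positivity
  have key : ∀ s ∈ Set.Ioo 0 t, ‖heat (t - s) (g s) x‖ₑ ≤
      ENNReal.ofReal (2 ^ n * B * d t) * ENNReal.ofReal ((1 + s) ^ (-σ)) := by
    intro s hs
    have hs0 : 0 < s := hs.1
    have hts : 0 < t - s := by linarith [hs.2]
    have hσs : 0 ≤ (1 + s) ^ (-σ) := by positivity
    rw [← ENNReal.ofReal_mul (by positivity)]
    rcases le_total s (t / 2) with h | h
    · have hd1 : d s ≤ 1 := Real.rpow_le_one_of_one_le_of_nonpos (by linarith)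
        (by simp; positivity)
      have hA : ∀ᵐ y, ‖g s y‖ₑ ≤ ENNReal.ofReal (B * (1 + s) ^ (-σ)) := by
        filter_upwards [h2 s hs0] with y hy
        refine hy.trans (ENNReal.ofReal_le_ofReal ?_)
        exact mul_le_of_le_one_right (by positivity) hd1
      refine (enorm_heat_le_decay hts (hg.integrable s hs0).1.aemeasurable (h1 s hs0) hA x).trans ?_
      rw [← ENNReal.ofReal_mul (by positivity)]
      refine ENNReal.ofReal_le_ofReal ?_
      have h3 : (1 + (t - s)) ^ (-((n : ℝ) / 2)) ≤ c * d t := half_rpow_le ht (by linarith)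
      calc c * (1 + (t - s)) ^ (-((n : ℝ) / 2)) * (B * (1 + s) ^ (-σ))
          ≤ c * (c * d t) * (B * (1 + s) ^ (-σ)) := by gcongr
        _ = (c * c) * B * d t * (1 + s) ^ (-σ) := by ring
        _ = _ := by rw [hcc]
    · refine (enorm_heat_le hts (h2 s hs0) x).trans (ENNReal.ofReal_le_ofReal ?_)
      have h3 : d s ≤ c * d t := half_rpow_le ht (by linarith)
      have h4 : c ≤ 2 ^ n := two_rpow_half_le n
      calc B * (1 + s) ^ (-σ) * d s ≤ B * (1 + s) ^ (-σ) * (2 ^ n * d t) := by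
            gcongr; exact h3.trans (by gcongr)
        _ = _ := by ring
  calc ‖duhamel g t x‖ₑ ≤ ∫⁻ s in Set.Ioo 0 t, ‖heat (t - s) (g s) x‖ₑ := enorm_duhamel_le g ht x
    _ ≤ ∫⁻ s in Set.Ioo 0 t, ENNReal.ofReal (2 ^ n * B * d t) * ENNReal.ofReal ((1 + s) ^ (-σ)) :=
        setLIntegral_mono' measurableSet_Ioo key
    _ ≤ ENNReal.ofReal (2 ^ n * B * d t) * ENNReal.ofReal (1 / (σ - 1)) := by
        rw [lintegral_const_mul' _ _ ENNReal.ofReal_ne_top]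
        gcongr
        exact lintegral_decay_le hσ ht
    _ = _ := by
        rw [← ENNReal.ofReal_mul (by positivity)]
        congr 1
        ring

/-! ### The nonlinearity -/

/-- `f(0) = 0` and `|f(ξ) - f(η)| ≤ K (|ξ|^{p-1} + |η|^{p-1}) |ξ - η|`, with `p > 1`. -/
structure IsPowerNonlinearity (K p : ℝ) (f : ℝ → ℝ) : Prop where
  one_lt : 1 < p
  pos : 0 < K
  zero : f 0 = 0
  abs_sub_le : ∀ ξ η : ℝ, |f ξ - f η| ≤ K * (|ξ| ^ (p - 1) + |η| ^ (p - 1)) * |ξ - η|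

variable {K p : ℝ} {f : ℝ → ℝ}

theorem IsPowerNonlinearity.abs_sub_le_of_le (hf : IsPowerNonlinearity K p f) {c ξ η : ℝ}
    (hξ : |ξ| ≤ c) (hη : |η| ≤ c) : |f ξ - f η| ≤ 2 * K * c ^ (p - 1) * |ξ - η| := by
  have hp : 0 ≤ p - 1 := by linarith [hf.one_lt]
  have hK := hf.pos
  refine (hf.abs_sub_le ξ η).trans ?_
  have h1 : |ξ| ^ (p - 1) ≤ c ^ (p - 1) := by gcongr
  have h2 : |η| ^ (p - 1) ≤ c ^ (p - 1) := by gcongr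
  have : K * (|ξ| ^ (p - 1) + |η| ^ (p - 1)) ≤ 2 * K * c ^ (p - 1) := by nlinarith
  gcongr

theorem IsPowerNonlinearity.abs_le_of_le (hf : IsPowerNonlinearity K p f) {c ξ : ℝ}
    (hξ : |ξ| ≤ c) : |f ξ| ≤ K * c ^ (p - 1) * |ξ| := by
  have hp : 0 < p - 1 := by linarith [hf.one_lt]
  have hK := hf.pos
  have h := hf.abs_sub_le ξ 0
  rw [hf.zero, abs_zero, Real.zero_rpow hp.ne', sub_zero, sub_zero, add_zero] at h
  refine h.trans ?_
  gcongr

theorem IsPowerNonlinearity.enorm_sub_le (hf : IsPowerNonlinearity K p f) {c ξ η : ℝ}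
    (hc : 0 ≤ c) (hξ : ‖ξ‖ₑ ≤ ENNReal.ofReal c) (hη : ‖η‖ₑ ≤ ENNReal.ofReal c) :
    ‖f ξ - f η‖ₑ ≤ ENNReal.ofReal (2 * K * c ^ (p - 1)) * ‖ξ - η‖ₑ := by
  have hK := hf.pos
  rw [← ofReal_norm, ENNReal.ofReal_le_ofReal_iff hc] at hξ hη
  rw [← ofReal_norm, ← ofReal_norm, ← ENNReal.ofReal_mul (by positivity)]
  exact ENNReal.ofReal_le_ofReal (hf.abs_sub_le_of_le hξ hη)

theorem IsPowerNonlinearity.enorm_le (hf : IsPowerNonlinearity K p f) {c ξ : ℝ}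
    (hc : 0 ≤ c) (hξ : ‖ξ‖ₑ ≤ ENNReal.ofReal c) :
    ‖f ξ‖ₑ ≤ ENNReal.ofReal (K * c ^ (p - 1)) * ‖ξ‖ₑ := by
  have hK := hf.pos
  rw [← ofReal_norm, ENNReal.ofReal_le_ofReal_iff hc] at hξ
  rw [← ofReal_norm, ← ofReal_norm, ← ENNReal.ofReal_mul (by positivity)]
  exact ENNReal.ofReal_le_ofReal (hf.abs_le_of_le hξ)

theorem IsPowerNonlinearity.continuous (hf : IsPowerNonlinearity K p f) : Continuous f := by
  refine continuous_iff_continuousAt.2 fun η => ?_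
  have hp : 0 ≤ p - 1 := by linarith [hf.one_lt]
  rw [ContinuousAt, tendsto_iff_norm_sub_tendsto_zero]
  have hc : Continuous fun ξ : ℝ => K * (|ξ| ^ (p - 1) + |η| ^ (p - 1)) * |ξ - η| :=
    (continuous_const.mul ((continuous_abs.rpow_const fun _ => .inr hp).add
      continuous_const)).mul (continuous_abs.comp (continuous_id.sub continuous_const))
  have := hc.tendsto η
  simp only [sub_self, abs_zero, mul_zero] at this
  exact squeeze_zero (fun _ => norm_nonneg _) (fun ξ => hf.abs_sub_le ξ η) this

theorem IsPowerNonlinearity.integrable_comp (hf : IsPowerNonlinearity K p f) {φ : Rn n → ℝ}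
    (hφ : Integrable φ) {A : ℝ≥0} (hA : ∀ᵐ x, ‖φ x‖ₑ ≤ A) : Integrable fun x => f (φ x) := by
  refine (hφ.norm.const_mul (K * (A : ℝ) ^ (p - 1))).mono'
    (hf.continuous.comp_aestronglyMeasurable hφ.1) ?_
  filter_upwards [hA] with x hx
  rw [enorm_eq_nnnorm, ENNReal.coe_le_coe] at hx
  exact hf.abs_le_of_le (by exact_mod_cast hx)

/-- On `|ξ| ≤ A` the function `f` is Lipschitz with constant `2K A^{p-1}` and vanishes at `0`, so
this one constant serves both the `L¹` continuity and the bounds. -/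
theorem IsPowerNonlinearity.isSource_comp (hf : IsPowerNonlinearity K p f) {A : ℝ≥0}
    {u : ℝ → Rn n → ℝ} (hu : IsSource A u) :
    IsSource (Real.toNNReal (2 * K * (A : ℝ) ^ (p - 1)) * A) fun s x => f (u s x) := by
  have hA : ENNReal.ofReal (A : ℝ) = A := ENNReal.ofReal_coe_nnreal
  have hle : ∀ s, 0 < s → ∀ᵐ x, ‖f (u s x)‖ₑ ≤
      ENNReal.ofReal (2 * K * (A : ℝ) ^ (p - 1)) * ‖u s x‖ₑ := fun s hs => by
    filter_upwards [hu.ae_le s hs] with x hx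
    have := hf.enorm_sub_le (c := A) (ξ := u s x) (η := 0) A.2 (by rwa [hA]) (by simp)
    simpa [hf.zero] using this
  refine ⟨fun s hs => hf.integrable_comp (hu.integrable s hs) (hu.ae_le s hs), fun s hs => ?_,
    fun s hs => ?_, fun s hs => ?_⟩
  · have h := ENNReal.Tendsto.const_mul (hu.tendsto s hs)
      (a := ENNReal.ofReal (2 * K * (A : ℝ) ^ (p - 1))) (.inr ENNReal.ofReal_ne_top)
    rw [mul_zero] at h
    refine tendsto_of_tendsto_of_tendsto_of_le_of_le' tendsto_const_nhds h
      (Eventually.of_forall fun _ => zero_le) ?_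
    filter_upwards [lt_mem_nhds hs] with r hr
    rw [← lintegral_const_mul' _ _ ENNReal.ofReal_ne_top]
    refine lintegral_mono_ae ?_
    filter_upwards [hu.ae_le s hs, hu.ae_le r hr] with x h1 h2
    exact hf.enorm_sub_le A.2 (by rwa [hA]) (by rwa [hA])
  · rw [ENNReal.coe_mul]
    refine (lintegral_mono_ae (hle s hs)).trans ?_
    rw [lintegral_const_mul' _ _ ENNReal.ofReal_ne_top]
    exact mul_le_mul_right (hu.lintegral_le s hs) _
  · filter_upwards [hle s hs, hu.ae_le s hs] with x h1 h2
    rw [ENNReal.coe_mul]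
    exact h1.trans (mul_le_mul_right h2 _)

end

section

variable {n : ℕ} {K p : ℝ} {f : ℝ → ℝ}

/-! ### The Picard map -/

/-- The right-hand side of the integral equation. -/
noncomputable def picard (f : ℝ → ℝ) (φ : Rn n → ℝ) (u : ℝ → Rn n → ℝ) (t : ℝ) (x : Rn n) : ℝ :=
  heat t φ x + duhamel (fun s y => f (u s y)) t x

/-- Curves in `C([0, ∞); L¹)` with `‖u(t)‖₁ ≤ M` and `‖u(t)‖_∞ ≤ M (1 + t)^{-n/2}`. -/
structure InBall (M : ℝ) (u : ℝ → Rn n → ℝ) : Prop where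
  integrable : ∀ t, 0 ≤ t → Integrable (u t)
  tendsto : ∀ t, 0 ≤ t → Tendsto (fun r => ∫⁻ x, ‖u r x - u t x‖ₑ) (𝓝[Set.Ici 0] t) (𝓝 0)
  lintegral_le : ∀ t, 0 ≤ t → ∫⁻ x, ‖u t x‖ₑ ≤ ENNReal.ofReal M
  ae_le : ∀ t, 0 ≤ t → ∀ᵐ x, ‖u t x‖ₑ ≤ ENNReal.ofReal (M * (1 + t) ^ (-((n : ℝ) / 2)))

/-- The smallness condition on the radius `M` of the ball. -/
structure IsSmallRadius (n : ℕ) (K p M : ℝ) : Prop where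
  pos : 0 < M
  one_lt : 1 < (n : ℝ) / 2 * (p - 1)
  small : 2 ^ n * (K * M ^ (p - 1) * (1 / ((n : ℝ) / 2 * (p - 1) - 1))) ≤ 1 / 4

variable {M : ℝ} {u v : ℝ → Rn n → ℝ} {φ : Rn n → ℝ}

theorem decay_rpow_le_one {t : ℝ} (ht : 0 ≤ t) : (1 + t) ^ (-((n : ℝ) / 2)) ≤ 1 :=
  Real.rpow_le_one_of_one_le_of_nonpos (by linarith) (by simp; positivity)

theorem InBall.isSource (hM : 0 ≤ M) (hu : InBall M u) : IsSource (Real.toNNReal M) u where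
  integrable s hs := hu.integrable s hs.le
  tendsto s hs := by
    have := hu.tendsto s hs.le
    rwa [nhdsWithin_eq_nhds.2 (Ici_mem_nhds hs)] at this
  lintegral_le s hs := hu.lintegral_le s hs.le
  ae_le s hs := by
    filter_upwards [hu.ae_le s hs.le] with x hx
    exact hx.trans (ENNReal.ofReal_le_ofReal (mul_le_of_le_one_right hM (decay_rpow_le_one hs.le)))

theorem mul_decay_rpow (hM : 0 ≤ M) {s : ℝ} (hs : 0 ≤ s) :
    (M * (1 + s) ^ (-((n : ℝ) / 2))) ^ (p - 1) =
      M ^ (p - 1) * (1 + s) ^ (-((n : ℝ) / 2 * (p - 1))) := by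
  rw [Real.mul_rpow hM (by positivity), ← Real.rpow_mul (by positivity), neg_mul]

theorem InBall.ae_enorm_comp_le (hf : IsPowerNonlinearity K p f) (hM : 0 ≤ M)
    (hu : InBall M u) {s : ℝ} (hs : 0 < s) :
    ∀ᵐ x, ‖f (u s x)‖ₑ ≤
      ENNReal.ofReal (K * M ^ (p - 1) * (1 + s) ^ (-((n : ℝ) / 2 * (p - 1)))) * ‖u s x‖ₑ := by
  filter_upwards [hu.ae_le s hs.le] with x hx
  have := hf.enorm_le (by positivity) hx
  rwa [mul_decay_rpow hM hs.le, ← mul_assoc] at this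

/-- The linear part takes at most half of the radius and the Duhamel part a quarter. The `2^n` in
the size of the datum compensates the smoothing constant `2^{n/2} ≤ 2^n`. -/
theorem InBall.picard (hf : IsPowerNonlinearity K p f) (hM : IsSmallRadius n K p M)
    (hu : InBall M u) (hφ : Integrable φ)
    (hφ1 : ∫⁻ x, ‖φ x‖ₑ ≤ ENNReal.ofReal (M / (2 * 2 ^ n)))
    (hφ2 : ∀ᵐ x, ‖φ x‖ₑ ≤ ENNReal.ofReal (M / (2 * 2 ^ n))) :
    InBall M (picard f φ u) := by
  have hM0 := hM.pos
  have hK := hf.pos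
  set σ := (n : ℝ) / 2 * (p - 1) with hσ
  have hσ1 : 1 < σ := hM.one_lt
  have hσ2 : 0 < σ - 1 := by linarith
  have h2n : (1 : ℝ) ≤ 2 ^ n := one_le_pow₀ one_le_two
  have hg := hf.isSource_comp (hu.isSource hM0.le)
  set B := K * M ^ (p - 1) * M with hB
  have hB0 : 0 ≤ B := by positivity
  have hsmall : 2 ^ n * (B * (1 / (σ - 1))) ≤ M / 4 := by
    have := mul_le_mul_of_nonneg_right hM.small hM0.le
    calc 2 ^ n * (B * (1 / (σ - 1))) = 2 ^ n * (K * M ^ (p - 1) * (1 / (σ - 1))) * M := by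
          rw [hB]; ring
      _ ≤ 1 / 4 * M := this
      _ = M / 4 := by ring
  have hs1 : ∀ s, 0 < s → ∫⁻ x, ‖f (u s x)‖ₑ ≤ ENNReal.ofReal (B * (1 + s) ^ (-σ)) := by
    intro s hs
    refine (lintegral_mono_ae (hu.ae_enorm_comp_le hf hM0.le hs)).trans ?_
    rw [lintegral_const_mul' _ _ ENNReal.ofReal_ne_top]
    refine (mul_le_mul_right (hu.lintegral_le s hs.le) _).trans (le_of_eq ?_)
    rw [← ENNReal.ofReal_mul (by positivity)]
    congr 1; rw [hB]; ring
  have hs2 : ∀ s, 0 < s → ∀ᵐ x, ‖f (u s x)‖ₑ ≤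
      ENNReal.ofReal (B * (1 + s) ^ (-σ) * (1 + s) ^ (-((n : ℝ) / 2))) := by
    intro s hs
    filter_upwards [hu.ae_enorm_comp_le hf hM0.le hs, hu.ae_le s hs.le] with x h1 h2
    refine h1.trans ((mul_le_mul_right h2 _).trans (le_of_eq ?_))
    rw [← ENNReal.ofReal_mul (by positivity)]
    congr 1; rw [hB]; ring
  have hM2 : M / (2 * 2 ^ n) ≤ M / 2 := by
    gcongr; linarith
  refine ⟨fun t ht => ?_, fun t ht => ?_, fun t ht => ?_, fun t ht => ?_⟩
  · refine (show Integrable (heat t φ) from ⟨aestronglyMeasurable_heat t hφ, ?_⟩).add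
      (show Integrable (duhamel (fun s y => f (u s y)) t) from
        ⟨(hg.measurable_duhamel ht).aestronglyMeasurable, ?_⟩)
    · exact (lintegral_enorm_heat_le hφ.1.aemeasurable).trans_lt hφ.2
    · exact (hg.lintegral_enorm_duhamel_le_of_decay hσ1 hB0 hs1 ht).trans_lt ENNReal.ofReal_lt_top
  · have h := ((tendsto_lintegral_heat_sub ht hφ).mono_left nhdsWithin_le_nhds).add
      (hg.tendsto_lintegral_duhamel ht)
    rw [add_zero] at h
    refine tendsto_of_tendsto_of_tendsto_of_le_of_le' tendsto_const_nhds h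
      (Eventually.of_forall fun _ => zero_le) ?_
    filter_upwards [self_mem_nhdsWithin] with r hr
    have hm : AEMeasurable fun x => ‖heat r φ x - heat t φ x‖ₑ :=
      ((aestronglyMeasurable_heat r hφ).sub (aestronglyMeasurable_heat t hφ)).enorm
    rw [← lintegral_add_left' hm]
    refine lintegral_mono fun x => ?_
    unfold SemilinearHeat.picard
    rw [add_sub_add_comm]
    exact enorm_add_le _ _
  · calc ∫⁻ x, ‖SemilinearHeat.picard f φ u t x‖ₑ
        ≤ ∫⁻ x, (‖heat t φ x‖ₑ + ‖duhamel (fun s y => f (u s y)) t x‖ₑ) :=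
          lintegral_mono fun x => enorm_add_le _ _
      _ ≤ ENNReal.ofReal (M / (2 * 2 ^ n)) + ENNReal.ofReal (B * (1 / (σ - 1))) := by
          rw [lintegral_add_left' (aestronglyMeasurable_heat t hφ).enorm]
          exact add_le_add ((lintegral_enorm_heat_le hφ.1.aemeasurable).trans hφ1)
            (hg.lintegral_enorm_duhamel_le_of_decay hσ1 hB0 hs1 ht)
      _ ≤ ENNReal.ofReal M := by
          rw [← ENNReal.ofReal_add (by positivity) (by positivity)]
          refine ENNReal.ofReal_le_ofReal ?_
          have : B * (1 / (σ - 1)) ≤ 2 ^ n * (B * (1 / (σ - 1))) :=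
            le_mul_of_one_le_left (by positivity) h2n
          linarith
  · have hh : ∀ᵐ x, ‖heat t φ x‖ₑ ≤
        ENNReal.ofReal (M / 2 * (1 + t) ^ (-((n : ℝ) / 2))) := by
      rcases ht.eq_or_lt with rfl | ht
      · rw [heat_of_nonpos le_rfl]
        filter_upwards [hφ2] with x hx
        refine hx.trans (ENNReal.ofReal_le_ofReal ?_)
        simpa using hM2
      · refine ae_of_all _ fun x => ?_
        refine (enorm_heat_le_decay ht hφ.1.aemeasurable hφ1 hφ2 x).trans ?_
        rw [← ENNReal.ofReal_mul (by positivity)]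
        refine ENNReal.ofReal_le_ofReal ?_
        calc (2 : ℝ) ^ ((n : ℝ) / 2) * (1 + t) ^ (-((n : ℝ) / 2)) * (M / (2 * 2 ^ n))
            ≤ 2 ^ n * (1 + t) ^ (-((n : ℝ) / 2)) * (M / (2 * 2 ^ n)) := by
              gcongr; exact two_rpow_half_le n
          _ = M / 2 * (1 + t) ^ (-((n : ℝ) / 2)) := by field_simp
    filter_upwards [hh] with x hx
    refine (enorm_add_le _ _).trans ((add_le_add hx
      (hg.enorm_duhamel_le_of_decay hσ1 hB0 hs1 hs2 ht x)).trans ?_)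
    rw [← ENNReal.ofReal_add (by positivity) (by positivity), ← add_mul]
    refine ENNReal.ofReal_le_ofReal ?_
    gcongr
    linarith

/-- The linear parts cancel, and on the ball `f` has at time `s` the Lipschitz constant `2K M^{p-1}
(1+s)^{-σ}`, of time integral at most `1/2`. No contraction in `L^∞` is needed, since the `L^∞`
bounds are closed constraints in `L¹`. -/
theorem InBall.lintegral_picard_sub_le (hf : IsPowerNonlinearity K p f)
    (hM : IsSmallRadius n K p M) (hu : InBall M u) (hv : InBall M v) {D : ℝ≥0∞}
    (hD : ∀ t, 0 ≤ t → ∫⁻ x, ‖u t x - v t x‖ₑ ≤ D) {t : ℝ} (ht : 0 ≤ t) :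
    ∫⁻ x, ‖SemilinearHeat.picard f φ u t x - SemilinearHeat.picard f φ v t x‖ₑ ≤
      ENNReal.ofReal (1 / 2) * D := by
  have hM0 := hM.pos
  have hK := hf.pos
  set σ := (n : ℝ) / 2 * (p - 1) with hσ
  have hσ1 : 1 < σ := hM.one_lt
  have hσ2 : 0 < σ - 1 := by linarith
  have h2n : (1 : ℝ) ≤ 2 ^ n := one_le_pow₀ one_le_two
  have hg := hf.isSource_comp (hu.isSource hM0.le)
  have hg' := hf.isSource_comp (hv.isSource hM0.le)
  have e : ∀ x, SemilinearHeat.picard f φ u t x - SemilinearHeat.picard f φ v t x =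
      duhamel (fun s y => f (u s y) - f (v s y)) t x := fun x => by
    rw [← hg.duhamel_sub hg' ht]
    unfold SemilinearHeat.picard
    ring
  simp only [e]
  calc ∫⁻ x, ‖duhamel (fun s y => f (u s y) - f (v s y)) t x‖ₑ
      ≤ ∫⁻ s in Set.Ioo 0 t, ENNReal.ofReal (2 * K * M ^ (p - 1)) * D *
          ENNReal.ofReal ((1 + s) ^ (-σ)) := by
        refine (hg.sub hg').lintegral_enorm_duhamel_le ht fun s hs => ?_
        have hs0 : 0 < s := hs.1
        calc ∫⁻ x, ‖f (u s x) - f (v s x)‖ₑ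
            ≤ ∫⁻ x, ENNReal.ofReal (2 * K * M ^ (p - 1) * (1 + s) ^ (-σ)) * ‖u s x - v s x‖ₑ := by
              refine lintegral_mono_ae ?_
              filter_upwards [hu.ae_le s hs0.le, hv.ae_le s hs0.le] with x h1 h2
              have := hf.enorm_sub_le (by positivity) h1 h2
              rwa [mul_decay_rpow hM0.le hs0.le, ← mul_assoc] at this
          _ ≤ ENNReal.ofReal (2 * K * M ^ (p - 1) * (1 + s) ^ (-σ)) * D := by
              rw [lintegral_const_mul' _ _ ENNReal.ofReal_ne_top]
              exact mul_le_mul_right (hD s hs0.le) _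
          _ = _ := by
              rw [ENNReal.ofReal_mul (by positivity)]
              ring
    _ = ENNReal.ofReal (2 * K * M ^ (p - 1)) *
          (∫⁻ s in Set.Ioo 0 t, ENNReal.ofReal ((1 + s) ^ (-σ))) * D := by
        rw [lintegral_const_mul _ (by fun_prop)]
        ring
    _ ≤ ENNReal.ofReal (2 * K * M ^ (p - 1)) * ENNReal.ofReal (1 / (σ - 1)) * D := by
        gcongr
        exact lintegral_decay_le hσ1 ht
    _ ≤ ENNReal.ofReal (1 / 2) * D := by
        rw [← ENNReal.ofReal_mul (by positivity)]
        gcongr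
        have h1 := hM.small
        have h2 : K * M ^ (p - 1) * (1 / (σ - 1)) ≤ 2 ^ n * (K * M ^ (p - 1) * (1 / (σ - 1))) :=
          le_mul_of_one_le_left (by positivity) h2n
        linarith

/-! ### The fixed point -/

/-- An `L¹`-convergent sequence has an a.e. convergent subsequence, along which the pointwise bound
survives. -/
theorem isClosed_setOf_ae_enorm_le (c : ℝ≥0∞) :
    IsClosed {F : Lp ℝ 1 (volume : Measure (Rn n)) | ∀ᵐ x, ‖F x‖ₑ ≤ c} := by
  refine IsSeqClosed.isClosed fun F G hF hG => ?_
  obtain ⟨ns, -, hns⟩ := (tendstoInMeasure_of_tendsto_Lp hG).exists_seq_tendsto_ae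
  filter_upwards [hns, ae_all_iff.2 hF] with x hx hFx
  exact le_of_tendsto hx.enorm (Eventually.of_forall fun i => hFx (ns i))

theorem edist_Lp_one (F G : Lp ℝ 1 (volume : Measure (Rn n))) :
    edist F G = ∫⁻ x, ‖F x - G x‖ₑ := by
  rw [Lp.edist_def, eLpNorm_one_eq_lintegral_enorm]
  rfl

theorem edist_toLp_one {φ ψ : Rn n → ℝ} (hφ : MemLp φ 1 volume) (hψ : MemLp ψ 1 volume) :
    edist (hφ.toLp φ) (hψ.toLp ψ) = ∫⁻ x, ‖φ x - ψ x‖ₑ := by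
  rw [Lp.edist_toLp_toLp, eLpNorm_one_eq_lintegral_enorm]
  rfl

/-- The bounded continuous curves in `L¹` that lie in the ball. -/
def ballSet (n : ℕ) (M : ℝ) :
    Set (BoundedContinuousFunction ℝ (Lp ℝ 1 (volume : Measure (Rn n)))) :=
  {U | InBall M fun t x => U t x}

theorem mem_ballSet_iff (U : BoundedContinuousFunction ℝ (Lp ℝ 1 (volume : Measure (Rn n)))) :
    U ∈ ballSet n M ↔ ∀ t, 0 ≤ t → (edist (U t) 0 ≤ ENNReal.ofReal M ∧
      U t ∈ {F : Lp ℝ 1 (volume : Measure (Rn n)) |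
        ∀ᵐ x, ‖F x‖ₑ ≤ ENNReal.ofReal (M * (1 + t) ^ (-((n : ℝ) / 2)))}) := by
  have h0 : ∀ t, edist (U t) 0 = ∫⁻ x, ‖U t x‖ₑ := fun t => by
    rw [edist_zero_right, Lp.enorm_def, eLpNorm_one_eq_lintegral_enorm]
  constructor
  · intro h t ht
    refine ⟨?_, h.ae_le t ht⟩
    rw [h0]
    exact h.lintegral_le t ht
  · intro h
    refine ⟨fun t _ => L1.integrable_coeFn _, fun t ht => ?_, fun t ht => ?_, fun t ht => (h t ht).2⟩
    · have := tendsto_iff_edist_tendsto_0.1 (U.continuous.tendsto t)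
      simp only [edist_Lp_one] at this
      exact this.mono_left nhdsWithin_le_nhds
    · rw [← h0]
      exact (h t ht).1

theorem isClosed_ballSet (n : ℕ) (M : ℝ) : IsClosed (ballSet n M) := by
  have : ballSet n M = ⋂ (t : ℝ) (_ : 0 ≤ t),
      ({U | edist (U t) 0 ≤ ENNReal.ofReal M} ∩
        (fun U : BoundedContinuousFunction ℝ (Lp ℝ 1 (volume : Measure (Rn n))) => U t) ⁻¹'
        {F | ∀ᵐ x, ‖F x‖ₑ ≤ ENNReal.ofReal (M * (1 + t) ^ (-((n : ℝ) / 2)))}) := by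
    ext U
    simp only [mem_ballSet_iff, Set.mem_iInter]
    rfl
  rw [this]
  refine isClosed_iInter fun t => isClosed_iInter fun _ => IsClosed.inter ?_ ?_
  · exact isClosed_le ((continuous_eval_const t).edist continuous_const)
      continuous_const
  · exact (isClosed_setOf_ae_enorm_le _).preimage (continuous_eval_const t)

/-- The curve is frozen at its initial value for negative times, so that it becomes a bounded
continuous function on all of `ℝ`. The ball only constrains `t ≥ 0`. -/
theorem InBall.exists_boundedContinuous (hu : InBall M u) :
    ∃ U : BoundedContinuousFunction ℝ (Lp ℝ 1 (volume : Measure (Rn n))),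
      U ∈ ballSet n M ∧ ∀ t, U t =ᵐ[volume] u (max t 0) := by
  have hm : ∀ t, MemLp (u (max t 0)) 1 volume := fun t =>
    memLp_one_iff_integrable.2 (hu.integrable _ (le_max_right t 0))
  have hc : Continuous fun t => (hm t).toLp (u (max t 0)) := by
    refine continuous_iff_continuousAt.2 fun t => ?_
    rw [ContinuousAt, tendsto_iff_edist_tendsto_0]
    simp only [edist_toLp_one]
    have h1 : Tendsto (fun r : ℝ => max r 0) (𝓝 t) (𝓝[Set.Ici 0] (max t 0)) := by
      refine tendsto_nhdsWithin_iff.2 ⟨(continuous_id.max continuous_const).tendsto t, ?_⟩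
      exact Eventually.of_forall fun r => le_max_right r 0
    exact (hu.tendsto _ (le_max_right t 0)).comp h1
  have hae : ∀ t, (hm t).toLp (u (max t 0)) =ᵐ[volume] u (max t 0) := fun t => (hm t).coeFn_toLp
  have hn : ∀ t, edist ((hm t).toLp (u (max t 0))) 0 ≤ ENNReal.ofReal M := fun t => by
    rw [edist_zero_right, Lp.enorm_toLp, eLpNorm_one_eq_lintegral_enorm]
    exact hu.lintegral_le _ (le_max_right t 0)
  have hn' : ∀ t, ‖(hm t).toLp (u (max t 0))‖ ≤ max M 0 := fun t => by
    have h := hn t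
    rw [edist_zero_right, ← ofReal_norm, ENNReal.ofReal_le_ofReal_iff'] at h
    exact le_max_iff.2 h
  refine ⟨BoundedContinuousFunction.ofNormedAddCommGroup _ hc (max M 0) hn', ?_, hae⟩
  rw [mem_ballSet_iff]
  intro t ht
  refine ⟨hn t, ?_⟩
  change ∀ᵐ x, ‖(hm t).toLp (u (max t 0)) x‖ₑ ≤ _
  filter_upwards [hae t, hu.ae_le t ht] with x h1 h2
  rw [h1, max_eq_left ht]
  exact h2

/-- Banach's fixed point theorem on the closed set `ballSet n M`, started at `0`. Each Picard
iterate is replaced by an `Lp`-valued curve that agrees with it a.e. at every time. -/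
theorem exists_inBall_fixedPoint (hf : IsPowerNonlinearity K p f) (hM : IsSmallRadius n K p M)
    (hφ : Integrable φ) (hφ1 : ∫⁻ x, ‖φ x‖ₑ ≤ ENNReal.ofReal (M / (2 * 2 ^ n)))
    (hφ2 : ∀ᵐ x, ‖φ x‖ₑ ≤ ENNReal.ofReal (M / (2 * 2 ^ n))) :
    ∃ u : ℝ → Rn n → ℝ, InBall M u ∧ ∀ t, 0 ≤ t → u t =ᵐ[volume] picard f φ u t := by
  classical
  have hM0 := hM.pos
  have hex : ∀ U : BoundedContinuousFunction ℝ (Lp ℝ 1 (volume : Measure (Rn n))),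
      U ∈ ballSet n M → ∃ V : BoundedContinuousFunction ℝ (Lp ℝ 1 (volume : Measure (Rn n))),
        V ∈ ballSet n M ∧ ∀ t, V t =ᵐ[volume] picard f φ (fun s x => U s x) (max t 0) :=
    fun U hU => (InBall.picard hf hM hU hφ hφ1 hφ2).exists_boundedContinuous
  choose! Ψ hΨS hΨ using hex
  have hcontr : ContractingWith (1 / 2) (Set.MapsTo.restrict Ψ _ _ hΨS) := by
    refine ⟨by rw [div_lt_one two_pos]; exact one_lt_two, fun U V => ?_⟩
    have hUV : ∀ t, 0 ≤ t → ∫⁻ x, ‖U.1 t x - V.1 t x‖ₑ ≤ edist U V := fun t _ => by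
      rw [← edist_Lp_one, Subtype.edist_eq, BoundedContinuousFunction.edist_eq_iSup]
      exact le_iSup (fun t => edist (U.1 t) (V.1 t)) t
    rw [Subtype.edist_eq, BoundedContinuousFunction.edist_eq_iSup]
    refine iSup_le fun t => ?_
    have h := InBall.lintegral_picard_sub_le (φ := φ) hf hM U.2 V.2 hUV (le_max_right t 0)
    have hhalf : ((1 / 2 : ℝ≥0) : ℝ≥0∞) = ENNReal.ofReal (1 / 2) := by
      rw [ENNReal.ofReal]
      congr 1
      ext
      simp
    rw [hhalf, edist_Lp_one]
    refine le_trans (le_of_eq (lintegral_congr_ae ?_)) h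
    filter_upwards [hΨ U.1 U.2 t, hΨ V.1 V.2 t] with x h1 h2
    rw [← h1, ← h2]
    rfl
  have h0 : (0 : BoundedContinuousFunction ℝ (Lp ℝ 1 (volume : Measure (Rn n)))) ∈ ballSet n M := by
    rw [mem_ballSet_iff]
    intro t ht
    refine ⟨by simp, ?_⟩
    have := Lp.coeFn_zero ℝ 1 (volume : Measure (Rn n))
    filter_upwards [this] with x hx
    simp only [BoundedContinuousFunction.coe_zero, Pi.zero_apply, hx, enorm_zero]
    exact zero_le
  obtain ⟨U, hU, hfix, -⟩ := ContractingWith.exists_fixedPoint' (isClosed_ballSet n M).isComplete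
    hΨS hcontr h0 (edist_ne_top _ _)
  refine ⟨fun t x => U t x, hU, fun t ht => ?_⟩
  have := hΨ U hU t
  rw [hfix, max_eq_left ht] at this
  exact this

end

section

variable {n : ℕ} {K p M : ℝ} {f : ℝ → ℝ} {u v : ℝ → Rn n → ℝ} {φ : Rn n → ℝ}

/-! ### Global solutions in `X` -/

theorem exists_isSmallRadius (hn : 1 ≤ n) (hp : 1 + 2 / (n : ℝ) < p) (hK : 0 < K) :
    ∃ M, IsSmallRadius n K p M := by
  have hn0 : (0 : ℝ) < n := by exact_mod_cast hn
  have hp1 : 2 / (n : ℝ) < p - 1 := by linarith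
  have hσ : 1 < (n : ℝ) / 2 * (p - 1) := by
    rw [div_lt_iff₀ hn0] at hp1
    linarith
  have hp0 : 0 < p - 1 := lt_trans (by positivity) hp1
  have hσ0 : 0 < (n : ℝ) / 2 * (p - 1) - 1 := by linarith
  set J := 1 / ((n : ℝ) / 2 * (p - 1) - 1) with hJ
  have hJ0 : 0 < J := by positivity
  -- This radius solves the smallness condition with equality.
  refine ⟨(1 / (4 * (2 ^ n * K * J))) ^ (1 / (p - 1)), by positivity, hσ, le_of_eq ?_⟩
  rw [← Real.rpow_mul (by positivity), one_div_mul_cancel hp0.ne', Real.rpow_one, ← hJ]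
  clear_value J
  field_simp

theorem isPowerNonlinearity (hn : 1 ≤ n) (hp : 1 + 2 / (n : ℝ) < p) (hK : 0 < K)
    (hf : ∀ ξ η : ℝ, |f ξ - f η| ≤ K * (|ξ| ^ (p - 1) + |η| ^ (p - 1)) * |ξ - η|)
    (hf0 : f 0 = 0) : IsPowerNonlinearity K p f := by
  have hn0 : (0 : ℝ) < n := by exact_mod_cast hn
  refine ⟨lt_trans ?_ hp, hK, hf0, hf⟩
  have : 0 < 2 / (n : ℝ) := by positivity
  linarith

/-- Sources are controlled only for `s > 0` so that this holds: `X` says nothing of `L^∞` at time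
`0`. -/
theorem InX.exists_isSource (hu : InX u) : ∃ A : ℝ≥0, IsSource A u := by
  obtain ⟨A₁, h₁⟩ := hu.bounded_L1
  obtain ⟨A₂, h₂⟩ := hu.bounded_Linfty
  refine ⟨max A₁ A₂, fun s hs => memLp_one_iff_integrable.1 (hu.continuous_L1.1 s hs.le),
    fun s hs => ?_, fun s hs => ?_, fun s hs => ?_⟩
  · have := hu.continuous_L1.2 s hs.le
    rw [nhdsWithin_eq_nhds.2 (Ici_mem_nhds hs)] at this
    simpa only [eLpNorm_one_eq_lintegral_enorm] using this
  · rw [← eLpNorm_one_eq_lintegral_enorm]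
    exact (h₁ s hs.le).trans (ENNReal.coe_le_coe.2 (le_max_left _ _))
  · have h := h₂ s hs
    rw [eLpNorm_exponent_top] at h
    filter_upwards [ae_le_eLpNormEssSup (f := u s) (μ := volume)] with x hx
    exact hx.trans (h.trans (ENNReal.coe_le_coe.2 (le_max_right _ _)))

theorem IsMildSolution.ae_eq_picard (h : IsMildSolution f φ u) {t : ℝ} (ht : 0 ≤ t) :
    u t =ᵐ[volume] picard f φ u t := h t ht

/-- No smallness is used: both solutions are bounded by some `c` in `L^∞`, where `f` has the
Lipschitz constant `2K c^{p-1}`. Gronwall with `A = 0` kills the `L¹` distance. -/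
theorem IsMildSolution.ae_eq (hf : IsPowerNonlinearity K p f) (hu : InX u) (hv : InX v)
    (hu' : IsMildSolution f φ u) (hv' : IsMildSolution f φ v) {t : ℝ} (ht : 0 ≤ t) :
    v t =ᵐ[volume] u t := by
  obtain ⟨A₁, hA₁⟩ := hu.exists_isSource
  obtain ⟨A₂, hA₂⟩ := hv.exists_isSource
  obtain ⟨B₁, hB₁⟩ := hu.bounded_L1
  obtain ⟨B₂, hB₂⟩ := hv.bounded_L1
  have hg₁ := hf.isSource_comp hA₁
  have hg₂ := hf.isSource_comp hA₂
  set c : ℝ := max A₁ A₂ with hc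
  have hc0 : 0 ≤ c := le_max_of_le_left A₁.2
  have hK := hf.pos
  set L := 2 * K * c ^ (p - 1) with hL
  have hL0 : 0 ≤ L := by positivity
  set F : ℝ → ℝ≥0∞ := fun t => ∫⁻ x, ‖v t x - u t x‖ₑ with hF
  have hFM : ∀ s, 0 ≤ s → F s ≤ (B₂ + B₁ : ℝ≥0) := fun s hs => by
    have h1 := hB₁ s hs
    have h2 := hB₂ s hs
    rw [eLpNorm_one_eq_lintegral_enorm] at h1 h2
    rw [ENNReal.coe_add]
    refine le_trans ?_ (add_le_add h2 h1)
    rw [← lintegral_add_left' (hv.continuous_L1.1 s hs).1.enorm]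
    exact lintegral_mono fun x => enorm_sub_le
  have hFle : ∀ s, 0 ≤ s → F s ≤ 0 + ∫⁻ r in Set.Ioo 0 s, ENNReal.ofReal L * F r := by
    intro s hs
    rw [zero_add]
    have e : F s = ∫⁻ x, ‖duhamel (fun s y => f (v s y) - f (u s y)) s x‖ₑ := by
      refine lintegral_congr_ae ?_
      filter_upwards [hu'.ae_eq_picard hs, hv'.ae_eq_picard hs] with x h1 h2
      rw [h1, h2, ← hg₂.duhamel_sub hg₁ hs]
      unfold picard
      congr 1
      ring
    rw [e]
    refine (hg₂.sub hg₁).lintegral_enorm_duhamel_le hs fun r hr => ?_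
    rw [hF, ← lintegral_const_mul' _ _ ENNReal.ofReal_ne_top]
    refine lintegral_mono_ae ?_
    filter_upwards [hA₁.ae_le r hr.1, hA₂.ae_le r hr.1] with x h1 h2
    refine hf.enorm_sub_le hc0 (h2.trans ?_) (h1.trans ?_)
    · rw [← ENNReal.ofReal_coe_nnreal]
      exact ENNReal.ofReal_le_ofReal (le_max_right _ _)
    · rw [← ENNReal.ofReal_coe_nnreal]
      exact ENNReal.ofReal_le_ofReal (le_max_left _ _)
  have h := lintegral_gronwall (b := fun _ => L) (B := fun s => L * s) (T := t) (F := F) (A := 0)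
    (M := (B₂ + B₁ : ℝ≥0))
    (fun s _ => by simpa using (hasDerivAt_id s).const_mul L) continuousOn_const (fun _ _ => hL0)
    (fun s hs => mul_nonneg hL0 hs) ENNReal.coe_ne_top (fun s hs => hFM s hs.1)
    (fun s hs => hFle s hs.1) t ⟨ht, le_rfl⟩
  have hm : AEMeasurable fun x => ‖v t x - u t x‖ₑ :=
    ((hv.continuous_L1.1 t ht).1.sub (hu.continuous_L1.1 t ht).1).enorm
  rw [mul_zero, zero_mul, nonpos_iff_eq_zero] at h
  replace h := (lintegral_eq_zero_iff' hm).1 h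
  filter_upwards [h] with x hx
  simpa [sub_eq_zero] using hx

theorem InBall.eLpNorm_top_le (hu : InBall M u) {t : ℝ} (ht : 0 ≤ t) :
    eLpNorm (u t) ∞ volume ≤ ENNReal.ofReal (M * (1 + t) ^ (-((n : ℝ) / 2))) := by
  rw [eLpNorm_exponent_top]
  exact eLpNormEssSup_le_of_ae_enorm_bound (hu.ae_le t ht)

theorem InBall.memLp_top (hu : InBall M u) {t : ℝ} (ht : 0 ≤ t) : MemLp (u t) ∞ volume :=
  ⟨(hu.integrable t ht).1, (hu.eLpNorm_top_le ht).trans_lt ENNReal.ofReal_lt_top⟩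

/-- The point is continuity in `L^∞` for `t > 0`. The linear part is controlled by `‖G_r - G_t‖₁
‖φ‖_∞`, which needs `t > 0`; the Duhamel part has a modulus of continuity uniform in `x`. -/
theorem InBall.inX (hf : IsPowerNonlinearity K p f) (hM : 0 ≤ M) (hu : InBall M u)
    (hφ : Integrable φ) (hφ' : MemLp φ ∞ volume)
    (hmild : ∀ t, 0 ≤ t → u t =ᵐ[volume] SemilinearHeat.picard f φ u t) : InX u where
  continuous_L1 := ⟨fun t ht => memLp_one_iff_integrable.2 (hu.integrable t ht), fun t ht => by
    simpa only [eLpNorm_one_eq_lintegral_enorm] using hu.tendsto t ht⟩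
  bounded_L1 := ⟨M.toNNReal, fun t ht => by
    rw [eLpNorm_one_eq_lintegral_enorm]
    exact hu.lintegral_le t ht⟩
  continuous_Linfty := by
    refine ⟨fun t ht => hu.memLp_top (le_of_lt ht), fun t ht => ?_⟩
    have ht0 : 0 < t := ht
    have hg := hf.isSource_comp (hu.isSource hM)
    have h1 := (ENNReal.Tendsto.mul_const (tendsto_lintegral_gaussKernel_sub (n := n) ht0)
      (b := eLpNorm φ ∞ volume) (.inr hφ'.2.ne)).mono_left
      (nhdsWithin_le_nhds (s := Set.Ioi 0))
    have h2 := (hg.tendsto_iSup_duhamel ht0.le).mono_left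
      (nhdsWithin_mono t Set.Ioi_subset_Ici_self)
    have h := h1.add h2
    rw [zero_mul, add_zero] at h
    refine tendsto_of_tendsto_of_tendsto_of_le_of_le' tendsto_const_nhds h
      (Eventually.of_forall fun _ => zero_le) ?_
    filter_upwards [self_mem_nhdsWithin] with r hr
    have hr0 : 0 < r := hr
    rw [eLpNorm_exponent_top]
    refine eLpNormEssSup_le_of_ae_enorm_bound ?_
    filter_upwards [hmild r hr0.le, hmild t ht0.le] with x e1 e2
    rw [e1, e2]
    unfold SemilinearHeat.picard
    rw [add_sub_add_comm]
    refine (enorm_add_le _ _).trans (add_le_add ?_ ?_)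
    · refine enorm_heat_sub_le ht0 hr0 hφ ?_ x
      rw [eLpNorm_exponent_top]
      exact ae_le_eLpNormEssSup
    · exact le_iSup (fun x => ‖duhamel (fun s y => f (u s y)) r x -
        duhamel (fun s y => f (u s y)) t x‖ₑ) x
  bounded_Linfty := ⟨M.toNNReal, fun t ht => by
    have ht0 : 0 ≤ t := le_of_lt ht
    refine (hu.eLpNorm_top_le ht0).trans (ENNReal.ofReal_le_ofReal ?_)
    exact mul_le_of_le_one_right hM (decay_rpow_le_one ht0)⟩

/-- Interpolation of `L^q` between `L¹` and `L^∞`. -/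
theorem eLpNorm_le_of_ae_le {ψ : Rn n → ℝ} {M d : ℝ} (hM : 0 ≤ M) (hd : 0 < d)
    (h1 : ∫⁻ x, ‖ψ x‖ₑ ≤ ENNReal.ofReal M) (h2 : ∀ᵐ x, ‖ψ x‖ₑ ≤ ENNReal.ofReal (M * d))
    {q : ℝ≥0∞} (hq : 1 ≤ q) :
    eLpNorm ψ q volume ≤ ENNReal.ofReal (M * d ^ (1 - (q⁻¹).toReal)) := by
  rcases eq_or_ne q ∞ with rfl | hqtop
  · rw [eLpNorm_exponent_top]
    simpa using eLpNormEssSup_le_of_ae_enorm_bound h2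
  · have hq0 : q ≠ 0 := (zero_lt_one.trans_le hq).ne'
    rw [eLpNorm_eq_lintegral_rpow_enorm_toReal hq0 hqtop, ENNReal.toReal_inv]
    set r := q.toReal with hr
    have hr1 : 1 ≤ r := by
      rw [hr, ← ENNReal.toReal_one]
      exact ENNReal.toReal_mono hqtop hq
    have hr0 : 0 < r := by linarith
    have h3 : ∫⁻ x, ‖ψ x‖ₑ ^ r ≤ ENNReal.ofReal (M * d) ^ (r - 1) * ENNReal.ofReal M := by
      refine le_trans ?_ (mul_le_mul_right h1 _)
      rw [← lintegral_const_mul' _ _ (ENNReal.rpow_ne_top_of_nonneg (by linarith)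
        ENNReal.ofReal_ne_top)]
      refine lintegral_mono_ae ?_
      filter_upwards [h2] with x hx
      have : ‖ψ x‖ₑ ^ r = ‖ψ x‖ₑ ^ (r - 1) * ‖ψ x‖ₑ := by
        conv_rhs => rw [← ENNReal.rpow_one ‖ψ x‖ₑ]
        rw [← ENNReal.rpow_mul, one_mul, ← ENNReal.rpow_add_of_nonneg _ _ (by linarith) zero_le_one,
          sub_add_cancel]
      rw [this]
      gcongr
    calc (∫⁻ x, ‖ψ x‖ₑ ^ r) ^ (1 / r)
        ≤ (ENNReal.ofReal (M * d) ^ (r - 1) * ENNReal.ofReal M) ^ (1 / r) := by gcongr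
      _ = ENNReal.ofReal (M * d ^ (1 - r⁻¹)) := by
          rw [ENNReal.ofReal_rpow_of_nonneg (by positivity) (by linarith),
            ← ENNReal.ofReal_mul (by positivity),
            ENNReal.ofReal_rpow_of_nonneg (by positivity) (by positivity)]
          congr 1
          rw [Real.mul_rpow hM hd.le, mul_right_comm, Real.mul_rpow (by positivity) (by positivity),
            ← Real.rpow_mul hd.le]
          congr 1
          · rcases hM.eq_or_lt with rfl | hM
            · simp [hr0.ne']
            · nth_rewrite 2 [← Real.rpow_one M]
              rw [← Real.rpow_add hM, sub_add_cancel, ← Real.rpow_mul hM.le, mul_one_div_cancel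
                hr0.ne', Real.rpow_one]
          · congr 1
            field_simp

theorem InBall.hasHeatDecay (hM : 0 ≤ M) (hu : InBall M u) : HasHeatDecay u := by
  refine ⟨M.toNNReal, fun q hq t ht => ?_⟩
  have hd : 0 < (1 + t) ^ (-((n : ℝ) / 2)) := by positivity
  refine (mul_le_mul_right (eLpNorm_le_of_ae_le hM hd (hu.lintegral_le t ht) (hu.ae_le t ht) hq)
    _).trans ?_
  rw [← ENNReal.ofReal_mul (by positivity)]
  refine ENNReal.ofReal_le_ofReal (le_of_eq ?_)
  rw [← Real.rpow_mul (by positivity), mul_left_comm, ← Real.rpow_add (by positivity)]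
  simp

theorem exists_solution (hf : IsPowerNonlinearity K p f) (hM : IsSmallRadius n K p M)
    (hφ : MemLp φ 1 volume) (hφ' : MemLp φ ∞ volume)
    (hsmall : eLpNorm φ 1 volume + eLpNorm φ ∞ volume ≤ ENNReal.ofReal (M / (2 * 2 ^ n))) :
    ∃ u : ℝ → Rn n → ℝ, InBall M u ∧ InX u ∧ IsMildSolution f φ u := by
  have hi := memLp_one_iff_integrable.1 hφ
  have h1 : ∫⁻ x, ‖φ x‖ₑ ≤ ENNReal.ofReal (M / (2 * 2 ^ n)) := by
    rw [← eLpNorm_one_eq_lintegral_enorm]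
    exact le_self_add.trans hsmall
  have h2 : ∀ᵐ x, ‖φ x‖ₑ ≤ ENNReal.ofReal (M / (2 * 2 ^ n)) := by
    filter_upwards [ae_le_eLpNormEssSup (f := φ) (μ := volume)] with x hx
    rw [← eLpNorm_exponent_top] at hx
    exact hx.trans (le_add_self.trans hsmall)
  obtain ⟨u, hu, hmild⟩ := exists_inBall_fixedPoint hf hM hi h1 h2
  exact ⟨u, hu, hu.inX hf hM.pos.le hi hφ' hmild, hmild⟩

end

section

variable {n : ℕ} {K p M : ℝ} {f : ℝ → ℝ} {u v : ℝ → Rn n → ℝ} {φ : Rn n → ℝ}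

/-! ### Weights -/

theorem add_pow_le_two_pow_mul (a b : ℝ≥0∞) (m : ℕ) : (a + b) ^ m ≤ 2 ^ m * (a ^ m + b ^ m) := by
  rcases le_total a b with h | h
  · calc (a + b) ^ m ≤ (2 * b) ^ m := by rw [two_mul]; gcongr
      _ = 2 ^ m * b ^ m := mul_pow _ _ _
      _ ≤ _ := by gcongr; exact le_add_self
  · calc (a + b) ^ m ≤ (2 * a) ^ m := by rw [two_mul]; gcongr
      _ = 2 ^ m * a ^ m := mul_pow _ _ _
      _ ≤ _ := by gcongr; exact le_self_add

/-- Truncation at `R` preserves quasi-subadditivity with the constant `2^m`, independent of `R`.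
Gronwall can thus be run on a bounded weight and the truncation removed afterwards. -/
theorem min_add_enorm_pow_le (R : ℝ≥0∞) (m : ℕ) (z y : Rn n) :
    min ‖z + y‖ₑ R ^ m ≤ 2 ^ m * ‖z‖ₑ ^ m + 2 ^ m * min ‖y‖ₑ R ^ m := by
  have h : min ‖z + y‖ₑ R ≤ ‖z‖ₑ + min ‖y‖ₑ R := by
    rw [← min_add_add_left]
    exact le_min (min_le_of_left_le (enorm_add_le z y)) (min_le_of_right_le le_add_self)
  rw [← mul_add]
  exact (pow_le_pow_left' h m).trans (add_pow_le_two_pow_mul _ _ m)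

/-- The weight `|x|^m` outside the ball of radius `R`. -/
noncomputable def tailWeight (m : ℕ) (R : ℝ) (x : Rn n) : ℝ≥0∞ :=
  {x : Rn n | R < ‖x‖}.indicator (fun x => ‖x‖ₑ ^ m) x

theorem tailWeight_of_lt {m : ℕ} {R : ℝ} {x : Rn n} (h : R < ‖x‖) :
    tailWeight m R x = ‖x‖ₑ ^ m := Set.indicator_of_mem (s := {x : Rn n | R < ‖x‖}) h _

theorem tailWeight_of_le {m : ℕ} {R : ℝ} {x : Rn n} (h : ‖x‖ ≤ R) :
    tailWeight m R x = 0 := Set.indicator_of_notMem (s := {x : Rn n | R < ‖x‖}) h.not_gt _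

theorem measurable_tailWeight (m : ℕ) (R : ℝ) : Measurable (tailWeight (n := n) m R) :=
  (measurable_enorm.pow_const m).indicator (measurableSet_lt measurable_const measurable_norm)

theorem tailWeight_le (m : ℕ) (R : ℝ) (x : Rn n) : tailWeight m R x ≤ ‖x‖ₑ ^ m :=
  Set.indicator_le_self _ _ _

/-- If `|z + y| > 2R`, the larger of `|z|` and `|y|` exceeds `R`, and `|z + y|` is at most twice it.
The price is the passage from radius `R` to `2R`. -/
theorem tailWeight_add_le (m : ℕ) (R : ℝ) (z y : Rn n) :
    tailWeight m (2 * R) (z + y) ≤ 2 ^ m * tailWeight m R z + 2 ^ m * tailWeight m R y := by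
  by_cases h : 2 * R < ‖z + y‖
  · rw [tailWeight_of_lt h]
    have h1 : ‖z + y‖ ≤ ‖z‖ + ‖y‖ := norm_add_le z y
    rcases le_total ‖z‖ ‖y‖ with h2 | h2
    · refine le_add_left ?_
      rw [tailWeight_of_lt (by linarith), ← mul_pow]
      refine pow_le_pow_left' ?_ m
      refine (enorm_add_le z y).trans ?_
      rw [two_mul]
      gcongr
      exact enorm_le_iff_norm_le.2 h2
    · refine le_add_right ?_
      rw [tailWeight_of_lt (by linarith), ← mul_pow]
      refine pow_le_pow_left' ?_ m
      refine (enorm_add_le z y).trans ?_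
      rw [two_mul]
      gcongr
      exact enorm_le_iff_norm_le.2 h2
  · rw [tailWeight_of_le (not_lt.1 h)]
    exact zero_le

theorem tailWeight_two_mul_le (m : ℕ) {R : ℝ} (hR : 0 ≤ R) (y : Rn n) :
    tailWeight m (2 * R) y ≤ 2 ^ m * tailWeight m R y := by
  have h := tailWeight_add_le m R 0 y
  rwa [tailWeight_of_le (x := (0 : Rn n)) (by simpa using hR), mul_zero, zero_add, zero_add] at h

theorem tendsto_lintegral_tailWeight (m : ℕ) (hφ : AEMeasurable φ)
    (h : ∫⁻ x, ‖x‖ₑ ^ m * ‖φ x‖ₑ ≠ ∞) :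
    Tendsto (fun k : ℕ => ∫⁻ x, tailWeight m k x * ‖φ x‖ₑ) atTop (𝓝 0) := by
  have : ∫⁻ _ : Rn n, (0 : ℝ≥0∞) = 0 := lintegral_zero
  rw [← this]
  refine tendsto_lintegral_of_dominated_convergence' (fun x => ‖x‖ₑ ^ m * ‖φ x‖ₑ)
    (fun k => (measurable_tailWeight m k).aemeasurable.mul hφ.enorm)
    (fun k => ae_of_all _ fun x => mul_le_mul_left (tailWeight_le m k x) _) h
    (ae_of_all _ fun x => ?_)
  obtain ⟨N, hN⟩ := exists_nat_ge ‖x‖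
  refine tendsto_const_nhds.congr' ?_
  filter_upwards [eventually_ge_atTop N] with k hk
  rw [tailWeight_of_le (hN.trans (Nat.cast_le.2 hk)), zero_mul]

theorem tendsto_lintegral_mul_of_eventually_eq {w : Rn n → ℝ≥0∞} {wk : ℕ → Rn n → ℝ≥0∞}
    (hm : ∀ k, Measurable (wk k)) (hmono : ∀ x, Monotone fun k => wk k x)
    (hev : ∀ x, ∀ᶠ k in atTop, wk k x = w x) (hφ : AEMeasurable φ) :
    Tendsto (fun k => ∫⁻ x, wk k x * ‖φ x‖ₑ) atTop (𝓝 (∫⁻ x, w x * ‖φ x‖ₑ)) := by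
  refine lintegral_tendsto_of_tendsto_of_monotone
    (fun k => (hm k).aemeasurable.mul hφ.enorm)
    (ae_of_all _ fun x i j hij => mul_le_mul_left (hmono x hij) _) (ae_of_all _ fun x => ?_)
  refine tendsto_const_nhds.congr' ?_
  filter_upwards [hev x] with k hk
  rw [hk]

theorem eventually_min_natCast {a : ℝ≥0∞} (ha : a ≠ ∞) :
    ∀ᶠ k : ℕ in atTop, min a (k : ℝ≥0∞) = a := by
  obtain ⟨N, hN⟩ := ENNReal.exists_nat_gt ha
  filter_upwards [eventually_ge_atTop N] with k hk
  exact min_eq_left (hN.le.trans (Nat.cast_le.2 hk))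

theorem InBall.continuousOn_lintegral_mul (hu : InBall M u) {w : Rn n → ℝ≥0∞} (hw : Measurable w)
    {k : ℝ≥0∞} (hk : k ≠ ∞) (hwk : ∀ x, w x ≤ k) :
    ContinuousOn (fun s => ∫⁻ x, w x * ‖u s x‖ₑ) (Set.Ici 0) := by
  intro s hs
  have hle : ∀ r r', 0 ≤ r → 0 ≤ r' → ∫⁻ x, w x * ‖u r x‖ₑ ≤
      (∫⁻ x, w x * ‖u r' x‖ₑ) + k * ∫⁻ x, ‖u r x - u r' x‖ₑ := by
    intro r r' hr hr'
    have hm : AEMeasurable fun x => w x * ‖u r' x‖ₑ :=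
      hw.aemeasurable.mul (hu.integrable r' hr').1.enorm
    rw [← lintegral_const_mul' _ _ hk, ← lintegral_add_left' hm]
    refine lintegral_mono fun x => ?_
    calc w x * ‖u r x‖ₑ ≤ w x * (‖u r' x‖ₑ + ‖u r x - u r' x‖ₑ) := by
          gcongr
          simpa using enorm_add_le (u r' x) (u r x - u r' x)
      _ ≤ _ := by
          rw [mul_add]
          gcongr
          exact hwk x
  have hδ := ENNReal.Tendsto.const_mul (hu.tendsto s hs) (a := k) (.inr hk)
  rw [mul_zero] at hδ
  have h1 := (tendsto_const_nhds (x := ∫⁻ x, w x * ‖u s x‖ₑ)).add hδ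
  have h2 := ENNReal.Tendsto.sub (tendsto_const_nhds (x := ∫⁻ x, w x * ‖u s x‖ₑ)) hδ
    (.inr ENNReal.zero_ne_top)
  rw [add_zero] at h1
  rw [tsub_zero] at h2
  refine tendsto_of_tendsto_of_tendsto_of_le_of_le' h2 h1 ?_ ?_
  · filter_upwards [self_mem_nhdsWithin] with r hr
    rw [tsub_le_iff_right]
    refine (hle s r hs hr).trans (le_of_eq ?_)
    congr 2
    exact lintegral_congr fun x => enorm_sub_rev _ _
  · filter_upwards [self_mem_nhdsWithin] with r hr
    exact hle r s hr hs

/-- For bounded weights the integral is continuous in `s`, by continuity in `L¹`; a finite weight is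
the increasing limit of its truncations. This supplies the measurability for dominated convergence
in time. -/
theorem InBall.aemeasurable_lintegral_mul (hu : InBall M u) {w : Rn n → ℝ≥0∞} (hw : Measurable w)
    (hwtop : ∀ x, w x ≠ ∞) (T : ℝ) :
    AEMeasurable (fun s => ∫⁻ x, w x * ‖u s x‖ₑ) (volume.restrict (Set.Ioo 0 T)) := by
  refine aemeasurable_of_tendsto_metrizable_ae' (f := fun (k : ℕ) s =>
    ∫⁻ x, min (w x) (k : ℝ≥0∞) * ‖u s x‖ₑ) (fun k => ?_) ?_
  · exact ((hu.continuousOn_lintegral_mul (hw.min measurable_const) (ENNReal.natCast_ne_top k)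
      fun x => min_le_right _ _).mono fun s hs => hs.1.le).aemeasurable measurableSet_Ioo
  · refine (ae_restrict_iff' measurableSet_Ioo).2 (ae_of_all _ fun s hs => ?_)
    exact tendsto_lintegral_mul_of_eventually_eq (fun k => hw.min measurable_const)
      (fun x i j hij => min_le_min_left _ (Nat.cast_le.2 hij))
      (fun x => eventually_min_natCast (hwtop x)) (hu.integrable s hs.1.le).1.aemeasurable

/-! ### Weighted estimates of solutions -/

/-- The weighted estimate of the integral equation, for a weight `w` with
`w(z + y) ≤ c (a(z) + w'(y))`. -/
theorem InBall.lintegral_weight_le (hf : IsPowerNonlinearity K p f) (hM : 0 ≤ M)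
    (hu : InBall M u) (hφ : Integrable φ)
    (hmild : ∀ t, 0 ≤ t → u t =ᵐ[volume] SemilinearHeat.picard f φ u t)
    {w a w' : Rn n → ℝ≥0∞} {c α : ℝ≥0∞} (hw : Measurable w) (hw' : Measurable w') (hc : c ≠ ∞)
    (hwab : ∀ z y, w (z + y) ≤ c * a z + c * w' y) (hww' : ∀ y, w y ≤ c * w' y)
    {T : ℝ} (ha : ∀ t, 0 < t → t ≤ T → ∫⁻ z, a z * ‖gaussKernel t z‖ₑ ≤ α)
    {t : ℝ} (ht : t ∈ Set.Icc 0 T) :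
    ∫⁻ x, w x * ‖u t x‖ₑ ≤
      c * α * (∫⁻ x, ‖φ x‖ₑ) + c * (∫⁻ x, w' x * ‖φ x‖ₑ) +
      ∫⁻ s in Set.Ioo 0 t, ENNReal.ofReal (K * M ^ (p - 1) * (1 + s) ^ (-((n : ℝ) / 2 * (p - 1)))) *
        (c * α * ENNReal.ofReal M + c * ∫⁻ x, w' x * ‖u s x‖ₑ) := by
  have hg := hf.isSource_comp (hu.isSource hM)
  -- The same estimate serves the datum and the source. The weights `w` and `w'` are kept apart
  -- because tail weights appear with radius `2R` on the left and `R` on the right.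
  have hheat : ∀ r, 0 ≤ r → r ≤ T → ∀ ψ : Rn n → ℝ, AEMeasurable ψ →
      ∫⁻ x, w x * ‖heat r ψ x‖ₑ ≤ c * α * (∫⁻ x, ‖ψ x‖ₑ) + c * ∫⁻ x, w' x * ‖ψ x‖ₑ := by
    intro r hr hrT ψ hψ
    have h := lintegral_mul_enorm_heat_le hr hψ hw (hw'.const_mul c) hwab hww' (α := c * α)
      fun hr => by
        simp only [mul_assoc]
        rw [lintegral_const_mul' _ _ hc]
        gcongr
        exact ha r hr hrT
    refine h.trans (le_of_eq ?_)
    simp only [mul_assoc]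
    rw [lintegral_const_mul' _ _ hc]
  calc ∫⁻ x, w x * ‖u t x‖ₑ
      ≤ ∫⁻ x, (w x * ‖heat t φ x‖ₑ + w x * ‖duhamel (fun s y => f (u s y)) t x‖ₑ) := by
        refine lintegral_mono_ae ?_
        filter_upwards [hmild t ht.1] with x hx
        rw [hx, ← mul_add]
        gcongr
        exact enorm_add_le _ _
    _ = (∫⁻ x, w x * ‖heat t φ x‖ₑ) + ∫⁻ x, w x * ‖duhamel (fun s y => f (u s y)) t x‖ₑ :=
        lintegral_add_left' (hw.aemeasurable.mul (aestronglyMeasurable_heat t hφ).enorm) _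
    _ ≤ _ := by
        refine add_le_add (hheat t ht.1 ht.2 φ hφ.1.aemeasurable) ?_
        refine (hg.lintegral_mul_enorm_duhamel_le ht.1 hw).trans ?_
        refine setLIntegral_mono' measurableSet_Ioo fun s hs => ?_
        refine (hheat (t - s) (by linarith [hs.2]) (by linarith [hs.1, ht.2]) _
          (hg.integrable s hs.1).1.aemeasurable).trans ?_
        set ℓ := ENNReal.ofReal (K * M ^ (p - 1) * (1 + s) ^ (-((n : ℝ) / 2 * (p - 1)))) with hℓ
        have hae := hu.ae_enorm_comp_le hf hM hs.1
        have h1 : ∫⁻ x, ‖f (u s x)‖ₑ ≤ ℓ * ENNReal.ofReal M := by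
          refine (lintegral_mono_ae hae).trans ?_
          rw [lintegral_const_mul' _ _ ENNReal.ofReal_ne_top]
          exact mul_le_mul_right (hu.lintegral_le s hs.1.le) _
        have h2 : ∫⁻ x, w' x * ‖f (u s x)‖ₑ ≤ ℓ * ∫⁻ x, w' x * ‖u s x‖ₑ := by
          rw [← lintegral_const_mul' _ _ ENNReal.ofReal_ne_top]
          refine lintegral_mono_ae ?_
          filter_upwards [hae] with x hx
          rw [mul_left_comm]
          gcongr
        calc c * α * (∫⁻ x, ‖f (u s x)‖ₑ) + c * ∫⁻ x, w' x * ‖f (u s x)‖ₑ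
            ≤ c * α * (ℓ * ENNReal.ofReal M) + c * (ℓ * ∫⁻ x, w' x * ‖u s x‖ₑ) := by gcongr
          _ = _ := by ring

/-- The growth of the moments of solutions. -/
theorem InBall.lintegral_pow_mul_le (hf : IsPowerNonlinearity K p f)
    (hM : IsSmallRadius n K p M) (hu : InBall M u) (hφ : Integrable φ)
    (hmild : ∀ t, 0 ≤ t → u t =ᵐ[volume] SemilinearHeat.picard f φ u t) (m : ℕ)
    {t : ℝ} (ht : 0 ≤ t) :
    ∫⁻ x, ‖x‖ₑ ^ m * ‖u t x‖ₑ ≤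
      2 * (2 ^ m * (ENNReal.ofReal (momentConst n m * t ^ ((m : ℝ) / 2)) *
          ((∫⁻ x, ‖φ x‖ₑ) + ENNReal.ofReal M) + ∫⁻ x, ‖x‖ₑ ^ m * ‖φ x‖ₑ)) *
        ENNReal.ofReal (Real.exp (2 * 2 ^ m)) := by
  have hM0 := hM.pos
  have hK := hf.pos
  have hm1 : ∀ R : ℝ≥0∞, Measurable fun x : Rn n => min ‖x‖ₑ R ^ m := fun R =>
    (measurable_enorm.min measurable_const).pow_const m
  set σ := (n : ℝ) / 2 * (p - 1) with hσ
  have hσ1 : 1 < σ := hM.one_lt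
  have hσ0 : 0 < σ - 1 := by linarith
  set L := K * M ^ (p - 1) with hL
  have hL0 : 0 ≤ L := by positivity
  set κ := ENNReal.ofReal (momentConst n m * t ^ ((m : ℝ) / 2)) with hκ
  -- The total mass in time of the coefficient is at most one, so the Gronwall factor stays bounded
  -- for all times.
  have hLJ : L * (1 / (σ - 1)) ≤ 1 := by
    have h1 := hM.small
    have h2 : L * (1 / (σ - 1)) ≤ 2 ^ n * (L * (1 / (σ - 1))) :=
      le_mul_of_one_le_left (by positivity) (one_le_pow₀ one_le_two)
    linarith
  have key : ∀ k : ℕ, ∫⁻ x, min ‖x‖ₑ (k : ℝ≥0∞) ^ m * ‖u t x‖ₑ ≤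
      2 * (2 ^ m * (κ * ((∫⁻ x, ‖φ x‖ₑ) + ENNReal.ofReal M) + ∫⁻ x, ‖x‖ₑ ^ m * ‖φ x‖ₑ)) *
        ENNReal.ofReal (Real.exp (2 * 2 ^ m)) := by
    intro k
    set F : ℝ → ℝ≥0∞ := fun s => ∫⁻ x, min ‖x‖ₑ (k : ℝ≥0∞) ^ m * ‖u s x‖ₑ with hF
    -- The bound depends on `k`, but Gronwall uses it only qualitatively, so the resulting estimate
    -- is uniform in `k`.
    have hFM : ∀ s ∈ Set.Icc 0 t, F s ≤ (k : ℝ≥0∞) ^ m * ENNReal.ofReal M := fun s hs => by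
      refine le_trans ?_ (mul_le_mul_right (hu.lintegral_le s hs.1) _)
      rw [← lintegral_const_mul' _ _ (ENNReal.pow_ne_top (ENNReal.natCast_ne_top k))]
      refine lintegral_mono fun x => ?_
      gcongr
      exact min_le_right _ _
    have hFle : ∀ s ∈ Set.Icc 0 t, F s ≤
        2 ^ m * (κ * ((∫⁻ x, ‖φ x‖ₑ) + ENNReal.ofReal M) + ∫⁻ x, ‖x‖ₑ ^ m * ‖φ x‖ₑ) +
          ∫⁻ r in Set.Ioo 0 s, ENNReal.ofReal (2 ^ m * L * (1 + r) ^ (-σ)) * F r := by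
      intro s hs
      refine (hu.lintegral_weight_le hf hM0.le hφ hmild (hm1 k) (hm1 k) (c := 2 ^ m) (α := κ)
        (a := fun z => ‖z‖ₑ ^ m) (by finiteness)
        (min_add_enorm_pow_le (k : ℝ≥0∞) m) (fun y => ?_) (T := t) (fun r hr hrt => ?_) hs).trans ?_
      · exact le_mul_of_one_le_left zero_le (one_le_pow₀ one_le_two)
      · refine (lintegral_pow_mul_gaussKernel_le hr m).trans (ENNReal.ofReal_le_ofReal ?_)
        have := momentConst_pos n m
        gcongr
      -- The term free of `F` is integrated against a mass at most one, leaving an inequality in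
      -- Gronwall form.
      · have hi : ∫⁻ r in Set.Ioo 0 s, ENNReal.ofReal (L * (1 + r) ^ (-σ)) *
            (2 ^ m * κ * ENNReal.ofReal M + 2 ^ m * F r) ≤ 2 ^ m * κ * ENNReal.ofReal M +
              ∫⁻ r in Set.Ioo 0 s, ENNReal.ofReal (2 ^ m * L * (1 + r) ^ (-σ)) * F r := by
          simp only [mul_add]
          rw [lintegral_add_left (by fun_prop)]
          refine add_le_add ?_ (le_of_eq ?_)
          · rw [lintegral_mul_const _ (by fun_prop)]
            refine mul_le_of_le_one_left zero_le ?_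
            simp only [ENNReal.ofReal_mul hL0]
            rw [lintegral_const_mul' _ _ ENNReal.ofReal_ne_top]
            refine (mul_le_mul_right (lintegral_decay_le hσ1 hs.1) _).trans ?_
            rw [← ENNReal.ofReal_mul hL0]
            exact ENNReal.ofReal_le_one.2 hLJ
          · refine setLIntegral_congr_fun measurableSet_Ioo fun r hr => ?_
            have hr0 : 0 < r := hr.1
            simp only [mul_assoc]
            rw [ENNReal.ofReal_mul (p := 2 ^ m) (by positivity), ENNReal.ofReal_pow (by positivity),
              ENNReal.ofReal_ofNat]
            ring
        have h2 : ∫⁻ x, min ‖x‖ₑ (k : ℝ≥0∞) ^ m * ‖φ x‖ₑ ≤ ∫⁻ x, ‖x‖ₑ ^ m * ‖φ x‖ₑ := by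
          refine lintegral_mono fun x => ?_
          gcongr
          exact min_le_left _ _
        refine (add_le_add (add_le_add le_rfl (mul_le_mul_right h2 _)) hi).trans (le_of_eq ?_)
        ring
    have h := lintegral_gronwall (b := fun r => 2 ^ m * L * (1 + r) ^ (-σ))
      (B := fun r => 2 ^ m * L * decayPrimitive σ r)
      (fun s hs => (hasDerivAt_decayPrimitive hσ1 hs).const_mul _)
      (continuousOn_const.mul (continuousOn_decay σ)) (fun s hs => by positivity)
      (fun s hs => mul_nonneg (by positivity) (decayPrimitive_nonneg hσ1 hs))
      (by finiteness) hFM hFle t ⟨ht, le_rfl⟩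
    refine h.trans ?_
    have h1 : 2 ^ m * L * decayPrimitive σ t ≤ 2 ^ m := by
      rw [mul_assoc]
      refine mul_le_of_le_one_right (by positivity) (le_trans ?_ hLJ)
      exact mul_le_mul_of_nonneg_left (decayPrimitive_le hσ1 ht) hL0
    gcongr
  exact le_of_tendsto' (tendsto_lintegral_mul_of_eventually_eq (fun k => hm1 k)
    (fun x i j hij => pow_le_pow_left' (min_le_min_left _ (Nat.cast_le.2 hij)) m)
    (fun x => (eventually_min_natCast (enorm_ne_top (x := x))).mono fun k hk => by rw [hk])
    (hu.integrable t ht).1.aemeasurable) key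

end

section

variable {n : ℕ} {K p M : ℝ} {f : ℝ → ℝ} {u v : ℝ → Rn n → ℝ} {φ : Rn n → ℝ}

/-! ### Continuity in the weighted space -/

/-- The moments of solutions are bounded on compact time intervals. -/
theorem InBall.exists_moment_bound (hf : IsPowerNonlinearity K p f)
    (hM : IsSmallRadius n K p M) (hu : InBall M u) (hφ : Integrable φ)
    (hmild : ∀ t, 0 ≤ t → u t =ᵐ[volume] SemilinearHeat.picard f φ u t) {m : ℕ}
    (hφm : ∫⁻ x, ‖x‖ₑ ^ m * ‖φ x‖ₑ ≠ ∞) (T : ℝ) :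
    ∃ B : ℝ≥0∞, B ≠ ∞ ∧ ∀ t ∈ Set.Icc 0 T, ∫⁻ x, ‖x‖ₑ ^ m * ‖u t x‖ₑ ≤ B := by
  have hφ1 : ∫⁻ x, ‖φ x‖ₑ ≠ ∞ := hφ.2.ne
  refine ⟨2 * (2 ^ m * (ENNReal.ofReal (momentConst n m * T ^ ((m : ℝ) / 2)) *
          ((∫⁻ x, ‖φ x‖ₑ) + ENNReal.ofReal M) + ∫⁻ x, ‖x‖ₑ ^ m * ‖φ x‖ₑ)) *
        ENNReal.ofReal (Real.exp (2 * 2 ^ m)), by finiteness, fun t ht => ?_⟩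
  refine (hu.lintegral_pow_mul_le hf hM hφ hmild m ht.1).trans ?_
  have := (momentConst_pos n m).le
  have := ht.1
  have := ht.2
  gcongr

/-- The moments of solutions are uniformly concentrated on compact time intervals. -/
theorem InBall.exists_tail_le (hf : IsPowerNonlinearity K p f)
    (hM : IsSmallRadius n K p M) (hu : InBall M u) (hφ : Integrable φ)
    (hmild : ∀ t, 0 ≤ t → u t =ᵐ[volume] SemilinearHeat.picard f φ u t) {m : ℕ}
    (hφm : ∫⁻ x, ‖x‖ₑ ^ m * ‖φ x‖ₑ ≠ ∞) (T : ℝ) {ε : ℝ≥0∞} (hε : 0 < ε) :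
    ∃ R : ℝ, ∀ t ∈ Set.Icc 0 T, ∫⁻ x, tailWeight m R x * ‖u t x‖ₑ ≤ ε := by
  have hM0 := hM.pos
  have hK := hf.pos
  set L := K * M ^ (p - 1) with hL
  have hL0 : 0 ≤ L := by positivity
  have hφ1 : ∫⁻ x, ‖φ x‖ₑ ≠ ∞ := hφ.2.ne
  obtain ⟨B, hB, hBle⟩ := hu.exists_moment_bound hf hM hφ hmild hφm T
  have hσ : 0 ≤ (n : ℝ) / 2 * (p - 1) := by linarith [hM.one_lt]
  set κ := momentConst n (m + 1) * T ^ (((m + 1 : ℕ) : ℝ) / 2) with hκ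
  set α : ℕ → ℝ≥0∞ := fun k => ENNReal.ofReal (κ / k) with hα
  set I : ℕ → ℝ≥0∞ := fun k =>
    ∫⁻ s in Set.Ioo 0 T, ∫⁻ x, tailWeight m k x * ‖u s x‖ₑ with hI
  have htailtop : ∀ (R : ℝ) (x : Rn n), tailWeight m R x ≠ ∞ := fun R x =>
    ne_top_of_le_ne_top (ENNReal.pow_ne_top enorm_ne_top) (tailWeight_le m R x)
  -- The tails vanish for each `s` and are dominated by the moment bound `B`.
  have hI0 : Tendsto I atTop (𝓝 0) := by
    have : ∫⁻ _ in Set.Ioo 0 T, (0 : ℝ≥0∞) = 0 := lintegral_zero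
    rw [← this]
    refine tendsto_lintegral_of_dominated_convergence' (fun _ => B)
      (fun k => hu.aemeasurable_lintegral_mul (measurable_tailWeight m k) (htailtop k) T)
      (fun k => (ae_restrict_iff' measurableSet_Ioo).2 (ae_of_all _ fun s hs => ?_)) ?_
      ((ae_restrict_iff' measurableSet_Ioo).2 (ae_of_all _ fun s hs => ?_))
    · exact (lintegral_mono fun x => mul_le_mul_left (tailWeight_le m k x) _).trans
        (hBle s ⟨hs.1.le, hs.2.le⟩)
    · rw [setLIntegral_const, Real.volume_Ioo]
      exact ENNReal.mul_ne_top hB ENNReal.ofReal_ne_top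
    · exact tendsto_lintegral_tailWeight m (hu.integrable s hs.1.le).1.aemeasurable
        (ne_top_of_le_ne_top hB (hBle s ⟨hs.1.le, hs.2.le⟩))
  have hα0 : Tendsto α atTop (𝓝 0) := by
    have := ENNReal.tendsto_ofReal (tendsto_const_div_atTop_nhds_zero_nat κ)
    rwa [ENNReal.ofReal_zero] at this
  set C := ENNReal.ofReal L * ENNReal.ofReal T * ENNReal.ofReal M with hC
  have htail0 := tendsto_lintegral_tailWeight m hφ.1.aemeasurable hφm
  have h2m : (2 : ℝ≥0∞) ^ m ≠ ∞ := by finiteness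
  have hlim : Tendsto (fun k : ℕ => 2 ^ m * (α k * ((∫⁻ x, ‖φ x‖ₑ) + C) +
      (∫⁻ x, tailWeight m k x * ‖φ x‖ₑ) + ENNReal.ofReal L * I k)) atTop (𝓝 0) := by
    have hQ : (∫⁻ x, ‖φ x‖ₑ) + C ≠ ∞ := by finiteness
    have h := ENNReal.Tendsto.const_mul (a := 2 ^ m)
      (((ENNReal.Tendsto.mul_const hα0 (.inr hQ)).add htail0).add
      (ENNReal.Tendsto.const_mul (a := ENNReal.ofReal L) hI0 (.inr ENNReal.ofReal_ne_top)))
      (.inr h2m)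
    simpa using h
  obtain ⟨k, hkε, hk0⟩ := ((ENNReal.tendsto_nhds_zero.1 hlim ε hε).and
    (eventually_gt_atTop 0)).exists
  have hk0' : (0 : ℝ) < k := by exact_mod_cast hk0
  -- No Gronwall argument is needed: the tail beyond `2k` at time `t` is bounded by the tails beyond
  -- `k` of the kernel, of `φ`, and of `u` integrated over `(0, T)`, all small uniformly in `t`.
  refine ⟨2 * k, fun t ht => le_trans ?_ hkε⟩
  refine (hu.lintegral_weight_le hf hM0.le hφ hmild (measurable_tailWeight m (2 * k))
    (measurable_tailWeight m k) h2m (tailWeight_add_le m k) (tailWeight_two_mul_le m hk0'.le)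
    (T := T) (α := α k) (fun r hr hrT => ?_) ht).trans ?_
  · refine le_trans (le_of_eq ?_) ((lintegral_tail_gaussKernel_le (n := n) hr hk0' m).trans
      (ENNReal.ofReal_le_ofReal ?_))
    · rw [← lintegral_indicator (measurableSet_lt measurable_const measurable_norm)]
      refine lintegral_congr fun x => ?_
      by_cases hx : (k : ℝ) < ‖x‖
      · rw [tailWeight_of_lt hx, Set.indicator_of_mem (by exact hx)]
      · rw [tailWeight_of_le (not_lt.1 hx), Set.indicator_of_notMem (by exact hx), zero_mul]
    · have := momentConst_pos n (m + 1)
      rw [hκ]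
      gcongr
  · have hi : ∫⁻ s in Set.Ioo 0 t,
        ENNReal.ofReal (L * (1 + s) ^ (-((n : ℝ) / 2 * (p - 1)))) *
          (2 ^ m * α k * ENNReal.ofReal M + 2 ^ m * ∫⁻ x, tailWeight m k x * ‖u s x‖ₑ) ≤
        2 ^ m * (α k * C + ENNReal.ofReal L * I k) := by
      calc ∫⁻ s in Set.Ioo 0 t, ENNReal.ofReal (L * (1 + s) ^ (-((n : ℝ) / 2 * (p - 1)))) *
            (2 ^ m * α k * ENNReal.ofReal M + 2 ^ m * ∫⁻ x, tailWeight m k x * ‖u s x‖ₑ)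
          ≤ ∫⁻ s in Set.Ioo 0 t, (ENNReal.ofReal L * (2 ^ m * α k * ENNReal.ofReal M) +
            ENNReal.ofReal L * 2 ^ m * ∫⁻ x, tailWeight m k x * ‖u s x‖ₑ) := by
            refine setLIntegral_mono' measurableSet_Ioo fun s hs => ?_
            rw [mul_assoc (ENNReal.ofReal L) (2 ^ m), ← mul_add]
            gcongr
            exact mul_le_of_le_one_right hL0 (Real.rpow_le_one_of_one_le_of_nonpos
              (by linarith [hs.1]) (by linarith))
        _ ≤ ∫⁻ s in Set.Ioo 0 T, (ENNReal.ofReal L * (2 ^ m * α k * ENNReal.ofReal M) +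
            ENNReal.ofReal L * 2 ^ m * ∫⁻ x, tailWeight m k x * ‖u s x‖ₑ) :=
            lintegral_mono_set (Set.Ioo_subset_Ioo_right ht.2)
        _ = _ := by
            rw [lintegral_add_left measurable_const, setLIntegral_const, Real.volume_Ioo, sub_zero,
              lintegral_const_mul' _ _ (by finiteness), hC]
            ring
    refine (add_le_add le_rfl hi).trans (le_of_eq ?_)
    ring

/-- Inside a ball of radius `R` the weight is at most `R^m`, and continuity in `L¹` suffices.
Outside, the tails at the times `r` and `t` are small separately, by the uniform bound on `[0, t +
1]`. -/
theorem InBall.tendsto_lintegral_pow_mul_sub (hf : IsPowerNonlinearity K p f)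
    (hM : IsSmallRadius n K p M) (hu : InBall M u) (hφ : Integrable φ)
    (hmild : ∀ t, 0 ≤ t → u t =ᵐ[volume] SemilinearHeat.picard f φ u t) {m : ℕ}
    (hφm : ∫⁻ x, ‖x‖ₑ ^ m * ‖φ x‖ₑ ≠ ∞) {t : ℝ} (ht : 0 ≤ t) :
    Tendsto (fun r => ∫⁻ x, ‖x‖ₑ ^ m * ‖u r x - u t x‖ₑ) (𝓝[Set.Ici 0] t) (𝓝 0) := by
  rw [ENNReal.tendsto_nhds_zero]
  intro ε hε
  have hε2 : 0 < ε / 2 := ENNReal.half_pos hε.ne'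
  have hε4 : 0 < ε / 2 / 2 := ENNReal.half_pos hε2.ne'
  obtain ⟨R, hR⟩ := hu.exists_tail_le hf hM hφ hmild hφm (t + 1) hε4
  have h1 := ENNReal.Tendsto.const_mul (a := ENNReal.ofReal R ^ m) (hu.tendsto t ht)
    (.inr (ENNReal.pow_ne_top ENNReal.ofReal_ne_top))
  rw [mul_zero] at h1
  have hev : ∀ᶠ r in 𝓝[Set.Ici 0] t, r < t + 1 :=
    nhdsWithin_le_nhds (gt_mem_nhds (by linarith))
  filter_upwards [ENNReal.tendsto_nhds_zero.1 h1 _ hε2, self_mem_nhdsWithin, hev] with r hr hr0 hrt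
  have hr0' : 0 ≤ r := hr0
  have hmr := (hu.integrable r hr0').1.enorm
  have hmt := (hu.integrable t ht).1.enorm
  have hw := measurable_tailWeight (n := n) m R
  calc ∫⁻ x, ‖x‖ₑ ^ m * ‖u r x - u t x‖ₑ
      ≤ ∫⁻ x, (ENNReal.ofReal R ^ m * ‖u r x - u t x‖ₑ +
          (tailWeight m R x * ‖u r x‖ₑ + tailWeight m R x * ‖u t x‖ₑ)) := by
        refine lintegral_mono fun x => ?_
        by_cases hx : R < ‖x‖
        · refine le_add_left ?_
          rw [tailWeight_of_lt hx, ← mul_add]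
          gcongr
          exact enorm_sub_le
        · refine le_add_right ?_
          gcongr
          rw [← ofReal_norm]
          exact ENNReal.ofReal_le_ofReal (not_lt.1 hx)
    _ = ENNReal.ofReal R ^ m * (∫⁻ x, ‖u r x - u t x‖ₑ) +
          ((∫⁻ x, tailWeight m R x * ‖u r x‖ₑ) + ∫⁻ x, tailWeight m R x * ‖u t x‖ₑ) := by
        have m1 : AEMeasurable fun x => tailWeight m R x * ‖u r x‖ₑ := hw.aemeasurable.mul hmr
        have m2 : AEMeasurable fun x => tailWeight m R x * ‖u t x‖ₑ := hw.aemeasurable.mul hmt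
        have m3 : AEMeasurable fun x => tailWeight m R x * ‖u r x‖ₑ + tailWeight m R x * ‖u t x‖ₑ :=
          m1.add m2
        rw [lintegral_add_right' _ m3, lintegral_add_left' m1,
          lintegral_const_mul' _ _ (by finiteness)]
    _ ≤ ε / 2 + (ε / 2 / 2 + ε / 2 / 2) :=
        add_le_add hr (add_le_add (hR r ⟨hr0', hrt.le⟩) (hR t ⟨ht, by linarith⟩))
    _ = ε := by rw [ENNReal.add_halves, ENNReal.add_halves]

/-! ### Monomials -/

theorem enorm_monomial_le (α : Fin n → ℕ) (x : Rn n) : ‖monomial α x‖ₑ ≤ ‖x‖ₑ ^ ∑ j, α j := by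
  have h : ‖monomial α x‖ ≤ ‖x‖ ^ ∑ j, α j := by
    unfold monomial
    rw [norm_prod, ← Finset.prod_pow_eq_pow_sum]
    refine Finset.prod_le_prod (fun j _ => norm_nonneg _) fun j _ => ?_
    rw [norm_pow]
    gcongr
    exact PiLp.norm_apply_le x j
  rw [← ofReal_norm, ← ofReal_norm, ← ENNReal.ofReal_pow (norm_nonneg _)]
  exact ENNReal.ofReal_le_ofReal h

theorem pow_le_one_add_pow (a : ℝ≥0∞) {k m : ℕ} (h : k ≤ m) : a ^ k ≤ 1 + a ^ m := by
  rcases le_total a 1 with h1 | h1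
  · exact le_add_right (pow_le_one' h1 k)
  · exact le_add_left (pow_le_pow_right₀ h1 h)

theorem continuous_monomial (α : Fin n → ℕ) : Continuous (monomial α) := by
  unfold monomial
  fun_prop

theorem eLpNorm_monomial_mul_le {ψ : Rn n → ℝ} (hψ : AEStronglyMeasurable ψ) {α : Fin n → ℕ}
    {m : ℕ} (hα : ∑ j, α j ≤ m) :
    eLpNorm (fun x => monomial α x * ψ x) 1 volume ≤
      (∫⁻ x, ‖ψ x‖ₑ) + ∫⁻ x, ‖x‖ₑ ^ m * ‖ψ x‖ₑ := by
  rw [eLpNorm_one_eq_lintegral_enorm, ← lintegral_add_left' hψ.enorm]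
  refine lintegral_mono fun x => ?_
  rw [enorm_mul, ← one_add_mul]
  gcongr
  exact (enorm_monomial_le α x).trans (pow_le_one_add_pow _ hα)

theorem memWeightedL1_of_lintegral {ψ : Rn n → ℝ} (hψ : Integrable ψ) {m : ℕ}
    (h : ∫⁻ x, ‖x‖ₑ ^ m * ‖ψ x‖ₑ ≠ ∞) : MemWeightedL1 m ψ := by
  refine ⟨memLp_one_iff_integrable.2 hψ, fun α hα =>
    ⟨(continuous_monomial α).aestronglyMeasurable.mul hψ.1, ?_⟩⟩
  exact (eLpNorm_monomial_mul_le hψ.1 hα).trans_lt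
    (ENNReal.add_lt_top.2 ⟨hψ.2, h.lt_top⟩)

theorem momentNorm_le (m : ℕ) (ψ : Rn n → ℝ) :
    momentNorm m ψ ≤ (multiIndices n m).card * ∫⁻ x, ‖x‖ₑ ^ m * ‖ψ x‖ₑ := by
  unfold momentNorm
  rw [← nsmul_eq_mul]
  refine Finset.sum_le_card_nsmul _ _ _ fun α hα => ?_
  rw [eLpNorm_one_eq_lintegral_enorm]
  refine lintegral_mono fun x => ?_
  rw [enorm_mul]
  gcongr
  have : ∑ j, α j = m := by simpa [multiIndices] using hα
  rw [← this]
  exact enorm_monomial_le α x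

theorem norm_le_sum_abs (x : Rn n) : ‖x‖ ≤ ∑ j, |x j| := by
  rw [EuclideanSpace.norm_eq]
  refine Real.sqrt_le_iff.2 ⟨by positivity, ?_⟩
  exact Finset.sum_sq_le_sq_sum_of_nonneg fun j _ => norm_nonneg _

/-- The Euclidean norm is at most the `ℓ¹` norm, whose power is handled by the power mean
inequality. -/
theorem norm_pow_le_sum (k : ℕ) (x : Rn n) :
    ‖x‖ ^ (k + 1) ≤ (n : ℝ) ^ k * ∑ j, |x j| ^ (k + 1) := by
  rcases Nat.eq_zero_or_pos n with rfl | hn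
  · have : x = 0 := Subsingleton.elim _ _
    simp [this]
  have h := pow_sum_div_card_le_sum_pow (s := Finset.univ) (f := fun j => |x j|)
    (fun j _ => abs_nonneg _) k
  rw [Finset.card_univ, Fintype.card_fin, div_le_iff₀' (by positivity)] at h
  exact (pow_le_pow_left₀ (norm_nonneg _) (norm_le_sum_abs x) _).trans h

/-- Among all monomials of degree `m`, the pure powers `x_j^m` already control `|x|^m`. -/
theorem lintegral_pow_mul_ne_top {m : ℕ} (hm : 1 ≤ m) (hφ : MemWeightedL1 m φ) :
    ∫⁻ x, ‖x‖ₑ ^ m * ‖φ x‖ₑ ≠ ∞ := by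
  obtain ⟨k, rfl⟩ := Nat.exists_eq_add_of_le' hm
  have hj : ∀ j : Fin n, Integrable fun x : Rn n => x j ^ (k + 1) * φ x := by
    intro j
    have h := memLp_one_iff_integrable.1 (hφ.2 (Pi.single j (k + 1)) (by simp))
    refine h.congr (ae_of_all _ fun x => ?_)
    have : monomial (Pi.single j (k + 1)) x = x j ^ (k + 1) := by
      unfold monomial
      rw [Finset.prod_eq_single j]
      · simp
      · intro i _ hi
        simp [Pi.single_eq_of_ne hi]
      · simp
    simp only [this]
  have hsum : Integrable fun x : Rn n => (n : ℝ) ^ k * ∑ j, ‖x j ^ (k + 1) * φ x‖ :=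
    (integrable_finsetSum _ fun j _ => (hj j).norm).const_mul _
  have hi : Integrable fun x : Rn n => ‖x‖ ^ (k + 1) * φ x := by
    refine hsum.mono' ((continuous_norm.pow _).aestronglyMeasurable.mul hφ.1.1)
      (ae_of_all _ fun x => ?_)
    have := mul_le_mul_of_nonneg_right (norm_pow_le_sum k x) (norm_nonneg (φ x))
    rw [norm_mul, norm_pow, norm_norm]
    refine this.trans (le_of_eq ?_)
    rw [mul_assoc, Finset.sum_mul]
    simp only [norm_mul, norm_pow, Real.norm_eq_abs]
  have := hi.2.ne
  simpa only [enorm_mul, enorm_pow, enorm_norm] using this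

/-! ### The weighted estimates of solutions in `X` -/

/-- Transfers the ball bounds from the constructed solution to any other solution in `X`, which
uniqueness identifies only a.e. at each time. -/
theorem InBall.congr_ae (hv : InBall M v) (h : ∀ t, 0 ≤ t → v t =ᵐ[volume] u t) :
    InBall M u where
  integrable t ht := (hv.integrable t ht).congr (h t ht)
  tendsto t ht := by
    refine (hv.tendsto t ht).congr' ?_
    filter_upwards [self_mem_nhdsWithin] with r hr
    refine lintegral_congr_ae ?_
    filter_upwards [h t ht, h r hr] with x h1 h2
    rw [h1, h2]
  lintegral_le t ht := by
    refine le_trans (le_of_eq (lintegral_congr_ae ?_)) (hv.lintegral_le t ht)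
    filter_upwards [h t ht] with x hx
    rw [hx]
  ae_le t ht := by
    filter_upwards [h t ht, hv.ae_le t ht] with x h1 h2
    rwa [← h1]

theorem InBall.continuousInWeightedL1 (hf : IsPowerNonlinearity K p f)
    (hM : IsSmallRadius n K p M) (hu : InBall M u) (hφ : Integrable φ)
    (hmild : ∀ t, 0 ≤ t → u t =ᵐ[volume] SemilinearHeat.picard f φ u t) {m : ℕ}
    (hφm : ∫⁻ x, ‖x‖ₑ ^ m * ‖φ x‖ₑ ≠ ∞) : ContinuousInWeightedL1 m (Set.Ici 0) u := by
  refine ⟨fun t ht => ?_, fun t ht => ?_⟩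
  · obtain ⟨B, hB, hle⟩ := hu.exists_moment_bound hf hM hφ hmild hφm t
    exact memWeightedL1_of_lintegral (hu.integrable t ht)
      (ne_top_of_le_ne_top hB (hle t ⟨ht, le_rfl⟩))
  · have h := (hu.tendsto t ht).add (hu.tendsto_lintegral_pow_mul_sub hf hM hφ hmild hφm ht)
    rw [add_zero] at h
    have hterm : ∀ k ∈ Finset.range (m + 1), ∀ α ∈ multiIndices n k,
        Tendsto (fun s => eLpNorm (fun x => monomial α x * (u s x - u t x)) 1 volume)
          (𝓝[Set.Ici 0] t) (𝓝 0) := by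
      intro k hk α hα
      refine tendsto_of_tendsto_of_tendsto_of_le_of_le' tendsto_const_nhds h
        (Eventually.of_forall fun _ => zero_le) ?_
      filter_upwards [self_mem_nhdsWithin] with r hr
      refine eLpNorm_monomial_mul_le ((hu.integrable r hr).1.sub (hu.integrable t ht).1) ?_
      have h1 : ∑ j, α j = k := by simpa [multiIndices] using hα
      rw [h1]
      exact Nat.lt_succ_iff.1 (Finset.mem_range.1 hk)
    unfold weightedL1Norm momentNorm
    have := tendsto_finsetSum _ fun k hk => tendsto_finsetSum _ (hterm k hk)
    simpa using this

theorem InBall.exists_momentNorm_le (hf : IsPowerNonlinearity K p f)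
    (hM : IsSmallRadius n K p M) (hu : InBall M u) (hφ : Integrable φ)
    (hmild : ∀ t, 0 ≤ t → u t =ᵐ[volume] SemilinearHeat.picard f φ u t) {m : ℕ}
    (hφm : ∫⁻ x, ‖x‖ₑ ^ m * ‖φ x‖ₑ ≠ ∞) :
    ∃ C : ℝ, 0 < C ∧ ∀ t : ℝ, 0 ≤ t →
      momentNorm m (u t) ≤ ENNReal.ofReal (C * (1 + t ^ ((m : ℝ) / 2))) := by
  have hφ1 : ∫⁻ x, ‖φ x‖ₑ ≠ ∞ := hφ.2.ne
  set N := ((∫⁻ x, ‖φ x‖ₑ) + ENNReal.ofReal M).toReal with hN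
  set E := (∫⁻ x, ‖x‖ₑ ^ m * ‖φ x‖ₑ).toReal with hE
  have hN' : (∫⁻ x, ‖φ x‖ₑ) + ENNReal.ofReal M = ENNReal.ofReal N :=
    (ENNReal.ofReal_toReal (by finiteness)).symm
  have hE' : ∫⁻ x, ‖x‖ₑ ^ m * ‖φ x‖ₑ = ENNReal.ofReal E := (ENNReal.ofReal_toReal hφm).symm
  have hN0 : 0 ≤ N := ENNReal.toReal_nonneg
  have hE0 : 0 ≤ E := ENNReal.toReal_nonneg
  have hc := momentConst_pos n m
  set c := momentConst n m
  set b := Real.exp (2 * 2 ^ m)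
  have hb : 0 < b := Real.exp_pos _
  have hle := fun t => momentNorm_le m (u t)
  generalize (multiIndices n m).card = D at hle
  -- Adding `1` makes the constant positive in every case, for instance when the other factors
  -- vanish.
  refine ⟨D * (2 * (2 ^ m * (c * N + E)) * b) + 1, by positivity,
    fun t ht => ?_⟩
  refine (hle t).trans ((mul_le_mul_right
    (hu.lintegral_pow_mul_le hf hM hφ hmild m ht) _).trans ?_)
  rw [hN', hE', ← ENNReal.ofReal_mul (by positivity), ← ENNReal.ofReal_add (by positivity) hE0,
    ← ENNReal.ofReal_ofNat, ← ENNReal.ofReal_pow (by positivity),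
    ← ENNReal.ofReal_mul (by positivity), ← ENNReal.ofReal_mul (by positivity),
    ← ENNReal.ofReal_mul (by positivity), ← ENNReal.ofReal_natCast,
    ← ENNReal.ofReal_mul (by positivity)]
  refine ENNReal.ofReal_le_ofReal ?_
  set τ := t ^ ((m : ℝ) / 2)
  have hτ : 0 ≤ τ := by positivity
  have h1 : c * τ * N + E ≤ (c * N + E) * (1 + τ) := by
    nlinarith [mul_nonneg hc.le hN0, mul_nonneg hE0 hτ]
  calc (D : ℝ) * (2 * (2 ^ m * (c * τ * N + E)) * b)
      ≤ D * (2 * (2 ^ m * ((c * N + E) * (1 + τ))) * b) := by gcongr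
    _ = D * (2 * (2 ^ m * (c * N + E)) * b) * (1 + τ) := by ring
    _ ≤ _ := by
      gcongr
      linarith

end

end SemilinearHeat

/-! ### Assembly of the two assertions. -/

theorem theorem1p2 (n : ℕ) (hn : 1 ≤ n) (p : ℝ) (hp : 1 + 2 / (n : ℝ) < p)
    (K : ℝ) (hK : 0 < K) (f : ℝ → ℝ)
    (hf : ∀ ξ η : ℝ, |f ξ - f η| ≤ K * (|ξ| ^ (p - 1) + |η| ^ (p - 1)) * |ξ - η|)
    (hf0 : f 0 = 0) :
    ∃ ε₀ : ℝ, 0 < ε₀ ∧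
      -- small data have a unique global mild solution in `X`, and it decays
      (∀ φ : SemilinearHeat.Rn n → ℝ, MemLp φ 1 volume → MemLp φ ∞ volume →
        eLpNorm φ 1 volume + eLpNorm φ ∞ volume ≤ ENNReal.ofReal ε₀ →
        ∃ u : ℝ → SemilinearHeat.Rn n → ℝ,
          SemilinearHeat.InX u ∧ SemilinearHeat.IsMildSolution f φ u ∧
          SemilinearHeat.HasHeatDecay u ∧
          ∀ v : ℝ → SemilinearHeat.Rn n → ℝ,
            SemilinearHeat.InX v → SemilinearHeat.IsMildSolution f φ v →
            ∀ t : ℝ, 0 ≤ t → v t =ᵐ[volume] u t) ∧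
      -- if moreover `φ ∈ L¹_m`, this solution has the weighted estimates of order `m`
      (∀ m : ℕ, 1 ≤ m → ∀ φ : SemilinearHeat.Rn n → ℝ,
        SemilinearHeat.MemWeightedL1 m φ → MemLp φ ∞ volume →
        eLpNorm φ 1 volume + eLpNorm φ ∞ volume ≤ ENNReal.ofReal ε₀ →
        ∀ u : ℝ → SemilinearHeat.Rn n → ℝ,
          SemilinearHeat.InX u → SemilinearHeat.IsMildSolution f φ u →
          SemilinearHeat.ContinuousInWeightedL1 m (Set.Ici 0) u ∧
          ∃ C : ℝ, 0 < C ∧ ∀ t : ℝ, 0 ≤ t →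
            SemilinearHeat.momentNorm m (u t) ≤
              ENNReal.ofReal (C * (1 + t ^ ((m : ℝ) / 2)))) := by
  obtain ⟨M, hM⟩ := SemilinearHeat.exists_isSmallRadius hn hp hK
  have hF := SemilinearHeat.isPowerNonlinearity hn hp hK hf hf0
  have hM0 := hM.pos
  -- The threshold depends on `n`, `K`, `p` only, not on `m`: the weighted estimates impose no
  -- further smallness.
  refine ⟨M / (2 * 2 ^ n), by positivity, fun φ hφ hφ' hsmall => ?_,
    fun m hm φ hφ hφ' hsmall u hu hmild => ?_⟩
  · obtain ⟨u, hball, hX, hmild⟩ := SemilinearHeat.exists_solution hF hM hφ hφ' hsmall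
    exact ⟨u, hX, hmild, hball.hasHeatDecay hM0.le,
      fun v hv hv' t ht => SemilinearHeat.IsMildSolution.ae_eq hF hX hv hmild hv' ht⟩
  · obtain ⟨v, hball, hX, hmild'⟩ := SemilinearHeat.exists_solution hF hM hφ.1 hφ' hsmall
    -- The given solution in `X` inherits the decay of the constructed one by uniqueness.
    have hball' : SemilinearHeat.InBall M u := hball.congr_ae fun t ht =>
      SemilinearHeat.IsMildSolution.ae_eq hF hu hX hmild hmild' ht
    have hi := memLp_one_iff_integrable.1 hφ.1
    have hφm := SemilinearHeat.lintegral_pow_mul_ne_top hm hφ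
    exact ⟨hball'.continuousInWeightedL1 hF hM hi hmild hφm,
      hball'.exists_momentNorm_le hF hM hi hmild hφm⟩
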